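/- Let $q$ be a prime power, $n>1$, and $K=\mathbb F_{q^n}$. Call a polynomial $\mathbf f\in\mathbb F_q[X_1,\dots,X_n]$ quasi-symmetric if it is invariant under the cyclic permutation $(1\,2\,\cdots\,n)$ of the variables, and call $f\in\mathbb F_q[t]$ $(n,q)$-quasi-symmetric if $f(t)=\mathbf f(t,t^q,\dots,t^{q^{n-1}})$ for a quasi-symmetric $\mathbf f\in\mathbb F_q[X_1,\dots,X_n]$. A linear polynomial over $K$ is one of the form $\sum_j a_jT^{p^j}$, where $p=\operatorname{char}K$. Theorem. Let $g,h\in\mathbb F_q[t]$ be $(n,q)$-quasi-symmetric polynomials such that $h$ has no zeros in $\mathbb F_{q^n}$ and $\deg g\le\deg h$. Suppose that $g/h$ is not the image of a rational function under a linear polynomial, in the following sense: there are no $u\in K(t)$ and no linear polynomials $L,M$ over $K$ with $\deg L>1$, $L(M(T))=T^{q^{n-1}}+T^{q^{n-2}}+\cdots+T$ and $g/h=L(u)$. Let $F_1=K(x_1)$ be a rational function field over $K$, and for $i\ge1$ let $F_{i+1}=F_i(x_{i+1})$, where $x_{i+1}$ satisfies $$x_{i+1}^{q^{n-1}}+x_{i+1}^{q^{n-2}}+\cdots+x_{i+1}=\frac{g(x_i)}{h(x_i)}.$$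 (All $F_i$ lie in a common extension field of $K$; the defining polynomials are not assumed to be irreducible.) Then the following hold. (i) All rational places of $F_1$ split completely in all steps of the tower: for every place $P$ of $F_1/K$ of degree one and every $i\ge1$, there are exactly $[F_i:F_1]$ places of $F_i$ above $P$, and above each place $Q$ of $F_i$ lying over $P$ there are exactly $[F_{i+1}:F_i]$ places of $F_{i+1}$. (ii) For every $i\ge1$ and every place $P$ of $F_i$ that is ramified in $F_{i+1}$ (that is, $e(P'|P)>1$ for some place $P'$ of $F_{i+1}$ above $P$), every place $P'$ of $F_{i+1}$ lying above $P$ is unramified in $F_{i+2}$ (that is, $e(P''|P')=1$ for all places $P''$ of $F_{i+2}$ above $P'$). -/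

import Mathlib

open Polynomial

noncomputable section

/-! ### Quasi-symmetric polynomials -/

/-- A polynomial in `n` variables is quasi-symmetric if it is fixed by the cyclic
permutation `(1 2 … n)` of the variables. -/
def IsQuasiSymmetric {R : Type*} [CommRing R] {n : ℕ} (f : MvPolynomial (Fin n) R) : Prop :=
  MvPolynomial.rename (finRotate n) f = f

/-- A one-variable polynomial `g(t)` with coefficients in `R` is `(n,q)`-quasi-symmetric if
`g(t) = f(t, t^q, …, t^(q^(n-1)))` for a quasi-symmetric polynomial `f` over `R`. -/
def IsNQQuasiSymmetric {R : Type*} [CommRing R] (n q : ℕ) (g : R[X]) : Prop :=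
  ∃ f : MvPolynomial (Fin n) R, IsQuasiSymmetric f ∧
    MvPolynomial.aeval (fun j : Fin n => (X : R[X]) ^ q ^ (j : ℕ)) f = g

/-! ### Linear (that is, additive) polynomials -/

/-- The trace polynomial `T^(q^(n-1)) + … + T^q + T`. -/
def tracePoly (R : Type*) [CommRing R] (n q : ℕ) : R[X] :=
  ∑ j ∈ Finset.range n, X ^ q ^ j

/-- A linear polynomial `∑ a_j T^(p^j)` over a field `K` of characteristic `p`. -/
def IsLinearized {K : Type*} [Field K] (L : K[X]) : Prop :=
  ∀ k : ℕ, L.coeff k ≠ 0 → ∃ j : ℕ, k = ringChar K ^ j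

/-- `L` is a nontrivial linear left factor of the linear polynomial `A`: both `L` and some `M`
are linear polynomials, `L` has degree greater than one, and `A(T) = L(M(T))`. -/
def IsLinearLeftFactor {K : Type*} [Field K] (L A : K[X]) : Prop :=
  IsLinearized L ∧ 1 < L.natDegree ∧ ∃ M : K[X], IsLinearized M ∧ A = L.comp M

/-! ### Places of function fields -/

/-- A place of `E/K`, given by its valuation ring: a valuation ring of `E` which contains `K`
and is different from `E`. -/
structure Place (K E : Type*) [Field K] [Field E] [Algebra K E] where
  ring : ValuationSubring E
  algebraMap_mem : ∀ a : K, algebraMap K E a ∈ ring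
  ne_top : ring ≠ ⊤

namespace Place

variable {K E E' : Type*} [Field K] [Field E] [Field E'] [Algebra K E] [Algebra K E']

/-- The valuation ring of a place of `E/K` is a `K`-algebra. -/
instance (P : Place K E) : Algebra K P.ring :=
  ((algebraMap K E).codRestrict P.ring.toSubring P.algebraMap_mem).toAlgebra

/-- The degree of a place: the degree over `K` of its residue field. -/
def degree (P : Place K E) : ℕ :=
  Module.finrank K (IsLocalRing.ResidueField P.ring)

/-- A rational place is a place of degree one. -/
def IsRational (P : Place K E) : Prop :=
  P.degree = 1

/-- The places of `E'` lying above the place `P` of `E`, for an extension `φ : E → E'`: those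
whose valuation ring meets `E` in the valuation ring of `P`. -/
def above (φ : E →ₐ[K] E') (P : Place K E) : Set (Place K E') :=
  {P' | P'.ring.comap φ.toRingHom = P.ring}

/-- The ramification index `e(P'|P)` of a place `P'` of `E'` over its restriction `P` to `E`:
the index of the value group of `P` in that of `P'`. The value group of `P'` is the quotient of
the unit group of `E'` by the units of the valuation ring of `P'`. -/
def ramificationIdx (φ : E →ₐ[K] E') (P' : Place K E') : ℕ :=
  (P'.ring.unitGroup ⊔ (Units.map (φ : E →* E')).range).index

/-- `P` splits completely in `E'` if there are exactly `[E' : E]` places of `E'` above `P`. -/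
def SplitsCompletely (φ : E →ₐ[K] E') (P : Place K E) : Prop :=
  (P.above φ).ncard = Module.finrank φ.fieldRange E'

/-- `P` is ramified in `E'` if some place of `E'` above it has ramification index `> 1`. -/
def IsRamified (φ : E →ₐ[K] E') (P : Place K E) : Prop :=
  ∃ P' ∈ P.above φ, 1 < P'.ramificationIdx φ

/-- `P` is unramified in `E'` if all places of `E'` above it have ramification index `1`. -/
def IsUnramified (φ : E →ₐ[K] E') (P : Place K E) : Prop :=
  ∀ P' ∈ P.above φ, P'.ramificationIdx φ = 1

end Place

/-! ### The fields of a tower -/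

section Tower

variable (K : Type*) {Ω : Type*} [Field K] [Field Ω] [Algebra K Ω]

/-- The field `F_i = K(x_1, …, x_i)`; thus `F_1 = K(x_1)` and `F_{i+1} = F_i(x_{i+1})`. -/
def towerField (x : ℕ → Ω) (i : ℕ) : IntermediateField K Ω :=
  IntermediateField.adjoin K (x '' Set.Icc 1 i)

theorem towerField_mono (x : ℕ → Ω) {i j : ℕ} (h : i ≤ j) :
    towerField K x i ≤ towerField K x j :=
  IntermediateField.adjoin.mono K _ _ (Set.image_mono (Set.Icc_subset_Icc_right h))

/-- The inclusion `F_i → F_j` for `i ≤ j`. -/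
def towerIncl (x : ℕ → Ω) {i j : ℕ} (h : i ≤ j) : towerField K x i →ₐ[K] towerField K x j :=
  IntermediateField.inclusion (towerField_mono K x h)

end Tower

end

/-!
The equation `Tr(x_{i+1}) = c`, with `c = g(x_i)/h(x_i)`, has a polynomial `Tr(T) - c` with
derivative `1`, so it is separable modulo every place where `c` is regular.  Everything follows from
the reduction of this polynomial modulo a place.

*Local theory.* All the valuation rings in question are discrete: a place of `K(x_1)` contains
`K[x_1]` or `K[x_1⁻¹]`, a place of a finite separable extension contains the integral closure of the
discrete valuation ring below it, and a valuation ring containing a Dedekind domain with the same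
fraction field is a localization of it (`ValuationSubring.isDiscreteValuationRing_and_exists_div`).
Let `R` be a discrete valuation ring with fraction field `E`, and `L = E(x)` with `x` a root of a
separable monic polynomial `F` over `R`.  Then the integral closure of `R` is `R[x]`
(`mem_adjoin_of_isIntegral`), so that a valuation ring above `R` is a localization of `R[x]`.
Modulo the maximal ideal of `R`, the minimal polynomial of the residue of `x` is a simple factor of
`F`, hence a uniformizer of `R` remains a uniformizer above
(`ValuationSubring.LiesAbove.exists_valuation_eq`).  If moreover `F` splits modulo the maximal
ideal, the valuation rings above `R` correspond to the roots of the reduced minimal polynomial of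
`x`, and there are `[L : E]` of them (`ncard_setOf_liesAbove`).

*Splitting.* At a rational place where `x_i` has residue `a`, the residue of `c` is `g(a)/h(a)`, and
at a rational pole of `x_i` it is the quotient of the coefficients of degree `deg h`.  In both cases
it is an element `b` with `b ^ q = b`: quasi-symmetry makes `g(a)` and `h(a)` invariant under the
`q`-th power map (`IsNQQuasiSymmetric.aeval_pow_eq`), and the coefficients lie in the field with `q`
elements.  Now `Tr(T) - b` divides `T ^ q ^ n - T`, so it splits over `K`
(`splits_tracePoly_sub_C`), the place splits completely, and all places above it are again rational.
Induction along the tower gives the first part.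

*Ramification.* A place `P` of `F_i` that ramifies in `F_{i+1}` is a pole of `c`, so `x_{i+1}` has a
pole at every place above `P`.  As `deg g ≤ deg h`, the quotient `g(x_{i+1})/h(x_{i+1})` is regular
there, and the next step is unramified.
-/

/-! ### Valuation rings containing a Dedekind domain -/

namespace ValuationSubring

theorem valuation_eq_one_iff_not_lt {L : Type*} [Field L] (V : ValuationSubring L) {z : L}
    (hz : z ∈ V) : V.valuation z = 1 ↔ ¬ V.valuation z < 1 :=
  ⟨fun h => h ▸ lt_irrefl _, fun h => le_antisymm ((V.valuation_le_one_iff z).2 hz) (not_lt.1 h)⟩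

theorem mem_of_isIntegral {R L : Type*} [CommRing R] [Field L] [Algebra R L]
    (V : ValuationSubring L) (hV : ∀ r : R, algebraMap R L r ∈ V) {z : L} (hz : IsIntegral R z) :
    z ∈ V := by
  obtain ⟨p, hp, hpz⟩ := hz
  have h : IsIntegral V z := by
    refine ⟨p.map ((algebraMap R L).codRestrict V hV), hp.map _, ?_⟩
    rw [eval₂_map]
    exact hpz
  obtain ⟨y, rfl⟩ := IsIntegrallyClosed.isIntegral_iff.1 h
  exact y.2

section Dedekind

variable {A L : Type*} [CommRing A] [IsDedekindDomain A] [Field L] [Algebra A L]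
  [IsFractionRing A L] (V : ValuationSubring L)

/-- A valuation ring `V ≠ L` of the fraction field `L` of a Dedekind domain `A ⊆ V` is the
localization of `A` at the prime ideal of the non-units of `V`: the localization is a discrete
valuation ring dominated by `V`. -/
theorem isDiscreteValuationRing_and_exists_div (hA : ∀ a : A, algebraMap A L a ∈ V) (hV : V ≠ ⊤) :
    IsDiscreteValuationRing V ∧ ∀ z ∈ V, ∃ r s : A,
      V.valuation (algebraMap A L s) = 1 ∧ z = algebraMap A L r / algebraMap A L s := by
  let j : A →+* V := (algebraMap A L).codRestrict V hA
  let : Algebra A V := j.toAlgebra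
  have hj (a : A) : ((algebraMap A V a : V) : L) = algebraMap A L a := rfl
  have hinj : Function.Injective (algebraMap A L) := IsFractionRing.injective A L
  let p : Ideal A := (IsLocalRing.maximalIdeal V).comap j
  have hp (a : A) : a ∈ p ↔ V.valuation (algebraMap A L a) < 1 := V.valuation_lt_one_iff (j a)
  have hp' (a : A) : a ∉ p ↔ V.valuation (algebraMap A L a) = 1 := by
    rw [hp, V.valuation_eq_one_iff_not_lt (hA a)]
  have : p.IsPrime := Ideal.comap_isPrime j _
  -- otherwise `V` would contain the fraction field of `A`
  have hp0 : p ≠ ⊥ := by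
    intro h0
    refine hV (top_le_iff.1 fun z _ => ?_)
    obtain ⟨a, b, hb, rfl⟩ := IsFractionRing.div_surjective (A := A) z
    have hb1 : V.valuation (algebraMap A L b) = 1 := by
      rw [← hp', h0, Ideal.mem_bot]
      exact nonZeroDivisors.ne_zero hb
    rw [← V.valuation_le_one_iff, map_div₀, hb1, div_one, V.valuation_le_one_iff]
    exact hA a
  have hdvr := IsLocalization.AtPrime.isDiscreteValuationRing_of_dedekind_domain A hp0
    (Localization.AtPrime p)
  have key : ∀ z ∈ V, ∃ r s : A,
      V.valuation (algebraMap A L s) = 1 ∧ z = algebraMap A L r / algebraMap A L s := by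
    intro z hz
    obtain ⟨a, b, hb, rfl⟩ := IsFractionRing.div_surjective (A := A) z
    have hb0 : algebraMap A L b ≠ 0 := by
      simpa using nonZeroDivisors.ne_zero hb
    have aux (a b : A) (h : algebraMap A (Localization.AtPrime p) a ∣ algebraMap A _ b) :
        ∃ r s : A, s ∉ p ∧ b * s = a * r := by
      obtain ⟨c, hc⟩ := h
      obtain ⟨⟨r, s⟩, hrs⟩ := IsLocalization.surj p.primeCompl c
      refine ⟨r, s, s.2, IsLocalization.injective (Localization.AtPrime p)
        p.primeCompl_le_nonZeroDivisors ?_⟩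
      rw [map_mul, map_mul, hc, mul_assoc, hrs]
    rcases ValuationRing.dvd_total (algebraMap A (Localization.AtPrime p) b) (algebraMap A _ a)
      with h | h
    · obtain ⟨r, s, hs, h⟩ := aux _ _ h
      have hs1 := (hp' s).1 hs
      have hs0 : algebraMap A L s ≠ 0 := fun h0 => by simp [h0] at hs1
      refine ⟨r, s, hs1, ?_⟩
      rw [div_eq_div_iff hb0 hs0, ← map_mul, ← map_mul, h, mul_comm]
    · obtain ⟨r, s, hs, h⟩ := aux _ _ h
      have hs1 := (hp' s).1 hs
      have h' := congrArg (algebraMap A L) h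
      rw [map_mul, map_mul] at h'
      have hs0 : algebraMap A L s ≠ 0 := fun h0 => by simp [h0] at hs1
      have hr0 : algebraMap A L r ≠ 0 := by
        intro h0
        rw [h0, mul_zero] at h'
        exact mul_ne_zero hb0 hs0 h'
      have hz' : algebraMap A L a / algebraMap A L b = algebraMap A L s / algebraMap A L r := by
        rw [div_eq_div_iff hb0 hr0, ← h', mul_comm]
      refine ⟨s, r, le_antisymm ((V.valuation_le_one_iff _).2 (hA r)) ?_, hz'⟩
      rw [← V.valuation_le_one_iff, hz', map_div₀, hs1] at hz
      have hr1 : 0 < V.valuation (algebraMap A L r) := by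
        rw [zero_lt_iff]; simpa using hr0
      simpa using (div_le_iff₀ hr1).1 hz
  refine ⟨?_, key⟩
  have : IsLocalization.AtPrime V p := by
    refine ⟨fun s => ?_, fun z => ?_, fun {a b} h => ⟨1, ?_⟩⟩
    · exact (V.valuation_eq_one_iff _).2 ((hp' s).1 s.2)
    · obtain ⟨r, s, hs, h⟩ := key z z.2
      refine ⟨⟨r, ⟨s, (hp' s).2 hs⟩⟩, Subtype.ext ?_⟩
      have hs0 : algebraMap A L s ≠ 0 := fun h0 => by simp [h0] at hs
      change (z : L) * algebraMap A L s = algebraMap A L r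
      rw [h, div_mul_cancel₀ _ hs0]
    · rw [hinj (congrArg Subtype.val h)]
  exact IsLocalization.AtPrime.isDiscreteValuationRing_of_dedekind_domain A hp0 V

end Dedekind

end ValuationSubring

/-! ### Unramified simple extensions of a discrete valuation ring -/

theorem isTorsionFree_of_isScalarTower (R E L : Type*) [CommRing R] [IsDomain R] [Field E]
    [Algebra R E] [IsFractionRing R E] [Field L] [Algebra E L] [Algebra R L]
    [IsScalarTower R E L] : Module.IsTorsionFree R L := by
  have : FaithfulSMul R L := (faithfulSMul_iff_algebraMap_injective R L).2 <| by
    rw [IsScalarTower.algebraMap_eq R E L]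
    exact (algebraMap E L).injective.comp (IsFractionRing.injective R E)
  infer_instance

section Extension

variable {R E L : Type*} [CommRing R] [IsDomain R] [IsDiscreteValuationRing R]
  [Field E] [Algebra R E] [IsFractionRing R E] [Field L] [Algebra E L] [Algebra R L]
  [IsScalarTower R E L] {x : L} {F : R[X]}

theorem finiteDimensional_and_isSeparable_of_aeval_eq_zero {R E L : Type*} [CommRing R]
    [Field E] [Algebra R E] [Field L] [Algebra E L] [Algebra R L] [IsScalarTower R E L]
    {x : L} {F : R[X]} (hx : IntermediateField.adjoin E {x} = ⊤)
    (hF : F.Monic) (hsep : F.Separable) (hFx : aeval x F = 0) :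
    FiniteDimensional E L ∧ Algebra.IsSeparable E L := by
  have hFx' : aeval x (F.map (algebraMap R E)) = 0 := by rwa [aeval_map_algebraMap]
  have hint : IsIntegral E x := ⟨_, hF.map _, hFx'⟩
  have hs : IsSeparable E x := (hsep.map (f := algebraMap R E)).of_dvd (minpoly.dvd _ _ hFx')
  have h1 := IntermediateField.adjoin.finiteDimensional hint
  have h2 := (IntermediateField.isSeparable_adjoin_simple_iff_isSeparable E L).2 hs
  rw [hx] at h1 h2
  exact ⟨Module.Finite.equiv IntermediateField.topEquiv.toLinearEquiv,
    Algebra.IsSeparable.of_algHom E _ IntermediateField.topEquiv.symm.toAlgHom⟩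

/-- If `L = E(x)` for a root `x` of a separable monic polynomial over `R`, then `R[x]` is integrally
closed in `L`: the discriminant of the power basis of `x` is a unit of `R`. -/
theorem mem_adjoin_of_isIntegral (hx : IntermediateField.adjoin E {x} = ⊤)
    (hF : F.Monic) (hsep : F.Separable) (hFx : aeval x F = 0) {z : L} (hz : IsIntegral R z) :
    z ∈ Algebra.adjoin R {x} := by
  obtain ⟨_, _⟩ := finiteDimensional_and_isSeparable_of_aeval_eq_zero (E := E) hx hF hsep hFx
  have hint : IsIntegral R x := ⟨F, hF, hFx⟩
  have : Algebra.IsAlgebraic E L := Algebra.IsAlgebraic.of_finite E L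
  let B : PowerBasis E L := PowerBasis.ofAdjoinEqTop (x := x) hint.tower_top
    (by
      rw [← IntermediateField.adjoin_simple_toSubalgebra_of_isAlgebraic
        (Algebra.IsAlgebraic.isAlgebraic x), hx]
      rfl)
  have hB : B.gen = x := rfl
  have hmem := Algebra.discr_mul_isIntegral_mem_adjoin E (B := B) (R := R) hint hz
  have := isTorsionFree_of_isScalarTower R E L
  -- the discriminant is, up to sign, the norm of a factor of `F'(x)`, which is a unit
  obtain ⟨G, hG⟩ := minpoly.isIntegrallyClosed_dvd hint hFx
  have hmp : minpoly E x = (minpoly R x).map (algebraMap R E) :=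
    minpoly.isIntegrallyClosed_eq_field_fractions E L (s := x) hint
  obtain ⟨a, b, hab⟩ := hsep
  have hunit : aeval x (derivative (minpoly R x)) * aeval x (b * G) = 1 := by
    have h := congrArg (aeval x) hab
    have h0 : aeval x (derivative F) = aeval x (derivative (minpoly R x)) * aeval x G := by
      rw [hG, derivative_mul, map_add, map_mul, map_mul, minpoly.aeval, zero_mul, add_zero]
    rw [map_add, map_mul, map_mul, hFx, h0, map_one] at h
    rw [map_mul]
    linear_combination h
  have hintP (P : R[X]) : IsIntegral R (aeval x P) :=
    IsIntegral.of_mem_of_fg _ hint.fg_adjoin_singleton _ (aeval_mem_adjoin_singleton R x)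
  obtain ⟨d, hd⟩ := IsIntegrallyClosed.isIntegral_iff.1
    (Algebra.isIntegral_norm E (hintP (b * G)))
  obtain ⟨e, he⟩ := IsIntegrallyClosed.isIntegral_iff.1
    (Algebra.isIntegral_norm E (hintP (derivative (minpoly R x))))
  have hed : algebraMap R E (e * d) = 1 := by
    rw [map_mul, he, hd, ← map_mul, hunit, map_one]
  have hdisc : Algebra.discr E B.basis =
      (-1) ^ (Module.finrank E L * (Module.finrank E L - 1) / 2) * algebraMap R E e := by
    rw [Algebra.discr_powerBasis_eq_norm, hB, hmp, derivative_map, aeval_map_algebraMap, he]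
  set s : R := (-1) ^ (Module.finrank E L * (Module.finrank E L - 1) / 2) with hs
  have hss : s * s = 1 := by
    rw [hs, ← mul_pow]; simp
  have hz' : z = (s * d) • (Algebra.discr E B.basis • z) := by
    rw [hdisc, ← algebraMap_smul E (s * d), smul_smul]
    have : algebraMap R E (s * d) * ((-1) ^ (Module.finrank E L * (Module.finrank E L - 1) / 2)
        * algebraMap R E e) = 1 := by
      rw [show (-1 : E) ^ (Module.finrank E L * (Module.finrank E L - 1) / 2) = algebraMap R E s by
        simp [hs], ← map_mul, ← map_mul,
        show s * d * (s * e) = (s * s) * (e * d) by ring, hss, one_mul, hed]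
    rw [this, one_smul]
  rw [hz']
  exact Subalgebra.smul_mem _ hmem _

end Extension

/-! ### Valuation rings above a discrete valuation ring -/

section Extension

variable {R E L : Type*} [CommRing R] [IsDomain R] [IsDiscreteValuationRing R]
  [Field E] [Algebra R E] [IsFractionRing R E] [Field L] [Algebra E L] [Algebra R L]
  [IsScalarTower R E L] {x : L} {F : R[X]} {V : ValuationSubring L}

namespace ValuationSubring

/-- `V` lies above `R`: it meets the fraction field `E` of `R` in `R`. The ring `R` need not be a
subring of `E`, so the condition is on the image of `R` in `E`. -/
def LiesAbove (R E : Type*) {L : Type*} [CommRing R] [Field E] [Algebra R E] [Field L]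
    [Algebra E L] (V : ValuationSubring L) : Prop :=
  ∀ e : E, algebraMap E L e ∈ V ↔ e ∈ Set.range (algebraMap R E)

namespace LiesAbove

theorem algebraMap_mem {R E L : Type*} [CommRing R] [Field E] [Algebra R E] [Field L]
    [Algebra E L] [Algebra R L] [IsScalarTower R E L] {V : ValuationSubring L}
    (hV : V.LiesAbove R E) (r : R) : algebraMap R L r ∈ V := by
  rw [IsScalarTower.algebraMap_apply R E L]
  exact (hV _).2 ⟨r, rfl⟩

theorem ne_top {R E L : Type*} [CommRing R] [IsDomain R] [IsDiscreteValuationRing R] [Field E]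
    [Algebra R E] [IsFractionRing R E] [Field L] [Algebra E L] {V : ValuationSubring L}
    (hV : V.LiesAbove R E) : V ≠ ⊤ := by
  rintro rfl
  refine IsDiscreteValuationRing.not_isField R ?_
  refine (MulEquiv.ofBijective (algebraMap R E) ⟨IsFractionRing.injective R E, fun e => ?_⟩).isField
    (Field.toIsField E)
  exact (hV e).1 (mem_top _)

theorem valuation_lt_one_iff (hV : V.LiesAbove R E) (r : R) :
    V.valuation (algebraMap R L r) < 1 ↔ r ∈ IsLocalRing.maximalIdeal R := by
  rw [IsLocalRing.mem_maximalIdeal, _root_.mem_nonunits_iff, iff_not_comm,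
    ← V.valuation_eq_one_iff_not_lt (hV.algebraMap_mem r)]
  have hmap (s : R) := IsScalarTower.algebraMap_apply R E L s
  constructor
  · rintro ⟨u, rfl⟩
    refine le_antisymm ((V.valuation_le_one_iff _).2 (hV.algebraMap_mem _)) ?_
    have h := congrArg (algebraMap R L) u.mul_inv
    rw [map_mul, map_one] at h
    rw [← map_one V.valuation, ← h, map_mul]
    exact mul_le_of_le_one_right' ((V.valuation_le_one_iff _).2 (hV.algebraMap_mem _))
  · intro h
    have h0 : algebraMap R E r ≠ 0 := by
      intro h0
      rw [hmap, h0] at h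
      simp at h
    have hinv : algebraMap E L (algebraMap R E r)⁻¹ ∈ V := by
      rw [← V.valuation_le_one_iff, map_inv₀, map_inv₀, ← hmap, h, inv_one]
    obtain ⟨s, hs⟩ := (hV _).1 hinv
    refine IsUnit.of_mul_eq_one s (IsFractionRing.injective R E ?_)
    rw [map_mul, hs, map_one, mul_inv_cancel₀ h0]

/-- A valuation ring above `R` is discrete, and it is a localization of the integral closure
of `R`. -/
theorem isDiscreteValuationRing_and_exists_div [FiniteDimensional E L] [Algebra.IsSeparable E L]
    (hV : V.LiesAbove R E) : IsDiscreteValuationRing V ∧ ∀ z ∈ V, ∃ r s : integralClosure R L,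
      V.valuation (s : L) = 1 ∧ z = (r : L) / s := by
  have := integralClosure.isDedekindDomain R E (L := L)
  have := integralClosure.isFractionRing_of_finite_extension (A := R) E L
  exact V.isDiscreteValuationRing_and_exists_div
    (A := integralClosure R L) (fun a => V.mem_of_isIntegral hV.algebraMap_mem a.2) hV.ne_top

theorem exists_aeval_div_aeval (hx : IntermediateField.adjoin E {x} = ⊤)
    (hF : F.Monic) (hsep : F.Separable) (hFx : aeval x F = 0) (hV : V.LiesAbove R E)
    {z : L} (hz : z ∈ V) :
    ∃ P Q : R[X], V.valuation (aeval x Q) = 1 ∧ z = aeval x P / aeval x Q := by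
  obtain ⟨_, _⟩ := finiteDimensional_and_isSeparable_of_aeval_eq_zero (E := E) hx hF hsep hFx
  obtain ⟨r, s, hs, rfl⟩ := hV.isDiscreteValuationRing_and_exists_div.2 z hz
  have aux (b : integralClosure R L) : ∃ P : R[X], aeval x P = b := by
    have := mem_adjoin_of_isIntegral (E := E) hx hF hsep hFx b.2
    rwa [Algebra.adjoin_singleton_eq_range_aeval] at this
  obtain ⟨P, hP⟩ := aux r
  obtain ⟨Q, hQ⟩ := aux s
  exact ⟨P, Q, by rw [hQ, hs], by rw [hP, hQ]⟩

theorem mem_of_monic {R E L : Type*} [CommRing R] [Field E] [Algebra R E] [Field L]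
    [Algebra E L] [Algebra R L] [IsScalarTower R E L] {x : L} {F : R[X]} {V : ValuationSubring L}
    (hF : F.Monic) (hFx : aeval x F = 0) (hV : V.LiesAbove R E) : x ∈ V :=
  V.mem_of_isIntegral hV.algebraMap_mem ⟨F, hF, hFx⟩

theorem aeval_mem {R E L : Type*} [CommRing R] [Field E] [Algebra R E] [Field L]
    [Algebra E L] [Algebra R L] [IsScalarTower R E L] {x : L} {V : ValuationSubring L}
    (hV : V.LiesAbove R E) (hx : x ∈ V) (P : R[X]) : aeval x P ∈ V := by
  rw [aeval_eq_sum_range]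
  refine sum_mem fun i _ => ?_
  rw [Algebra.smul_def]
  exact V.mul_mem _ _ (hV.algebraMap_mem _) (pow_mem hx i)

theorem isLocalHom_codRestrict (hV : V.LiesAbove R E) :
    IsLocalHom ((algebraMap R L).codRestrict V hV.algebraMap_mem) := by
  refine ⟨fun r hr => ?_⟩
  by_contra h
  have h1 := (hV.valuation_lt_one_iff r).2 h
  exact (V.valuation_lt_one_iff _).2 h1 hr

/-- The residue field embedding `R/𝔪 → V/𝔪_V` for a valuation ring `V` above `R`. -/
noncomputable def residueMap (hV : V.LiesAbove R E) :
    IsLocalRing.ResidueField R →+* IsLocalRing.ResidueField V :=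
  letI := hV.isLocalHom_codRestrict
  IsLocalRing.ResidueField.map ((algebraMap R L).codRestrict V hV.algebraMap_mem)

theorem residueMap_residue (hV : V.LiesAbove R E) (r : R) :
    hV.residueMap (IsLocalRing.residue R r) =
      IsLocalRing.residue V ⟨algebraMap R L r, hV.algebraMap_mem r⟩ := rfl

theorem residue_aeval (hV : V.LiesAbove R E) (hx : x ∈ V) (P : R[X]) :
    IsLocalRing.residue V ⟨aeval x P, hV.aeval_mem hx P⟩ =
      (P.map (IsLocalRing.residue R)).eval₂ hV.residueMap (IsLocalRing.residue V ⟨x, hx⟩) := by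
  have h : (⟨aeval x P, hV.aeval_mem hx P⟩ : V) =
      P.eval₂ ((algebraMap R L).codRestrict V hV.algebraMap_mem) ⟨x, hx⟩ := by
    apply Subtype.ext
    change aeval x P = V.subtype _
    rw [hom_eval₂]
    rfl
  rw [h, hom_eval₂, eval₂_map]
  rfl

theorem valuation_aeval_lt_one_iff (hV : V.LiesAbove R E) (hx : x ∈ V) (P : R[X]) :
    V.valuation (aeval x P) < 1 ↔
      (P.map (IsLocalRing.residue R)).eval₂ hV.residueMap (IsLocalRing.residue V ⟨x, hx⟩) = 0 := by
  rw [← hV.residue_aeval hx, IsLocalRing.residue_eq_zero_iff, V.valuation_lt_one_iff]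

/-- If `L = E(x)` for a root `x` of a polynomial over `R` that is separable modulo the maximal
ideal, then the valuation rings of `L` above `R` have the same value group as `R`. -/
theorem exists_valuation_eq (hx : IntermediateField.adjoin E {x} = ⊤)
    (hF : F.Monic) (hsep : F.Separable) (hFx : aeval x F = 0) (hV : V.LiesAbove R E)
    {z : L} (hz : z ≠ 0) : ∃ e : E, V.valuation z = V.valuation (algebraMap E L e) := by
  obtain ⟨_, _⟩ := finiteDimensional_and_isSeparable_of_aeval_eq_zero (E := E) hx hF hsep hFx
  have hdvr := hV.isDiscreteValuationRing_and_exists_div.1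
  have hxV := hV.mem_of_monic hF hFx
  obtain ⟨π, hπ⟩ := IsDiscreteValuationRing.exists_irreducible R
  have hπm := hπ.maximalIdeal_eq
  have hπ0 : algebraMap R L π ≠ 0 := by
    rw [IsScalarTower.algebraMap_apply R E L]
    simpa using hπ.ne_zero
  set v := V.valuation
  have hle (P : R[X]) : v (aeval x P) ≤ 1 := (V.valuation_le_one_iff _).2 (hV.aeval_mem hxV P)
  have hker (P : R[X]) (hP : P.map (IsLocalRing.residue R) = 0) :
      v (aeval x P) ≤ v (algebraMap R L π) := by
    have : C π ∣ P := by
      rw [C_dvd_iff_dvd_coeff]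
      intro i
      rw [← Ideal.mem_span_singleton, ← hπm, ← IsLocalRing.residue_eq_zero_iff, ← coeff_map, hP,
        coeff_zero]
    obtain ⟨Q, rfl⟩ := this
    rw [map_mul, aeval_C, map_mul]
    exact mul_le_of_le_one_right' (hle Q)
  let : Algebra (IsLocalRing.ResidueField R) (IsLocalRing.ResidueField V) :=
    hV.residueMap.toAlgebra
  set y := IsLocalRing.residue V ⟨x, hxV⟩ with hy
  have hval (P : R[X]) : v (aeval x P) < 1 ↔ aeval y (P.map (IsLocalRing.residue R)) = 0 :=
    hV.valuation_aeval_lt_one_iff hxV P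
  have hFy : aeval y (F.map (IsLocalRing.residue R)) = 0 := by
    rw [← hval, hFx, map_zero]; exact zero_lt_one
  obtain ⟨ψ, hψ⟩ := minpoly.dvd _ _ hFy
  have hcop : IsCoprime (minpoly (IsLocalRing.ResidueField R) y) ψ :=
    Separable.isCoprime (hψ ▸ hsep.map)
  obtain ⟨f, hf⟩ := map_surjective _ IsLocalRing.residue_surjective
    (minpoly (IsLocalRing.ResidueField R) y)
  obtain ⟨g, hg⟩ := map_surjective _ IsLocalRing.residue_surjective ψ
  have hg1 : v (aeval x g) = 1 := by
    rw [V.valuation_eq_one_iff_not_lt (hV.aeval_mem hxV g), hval, hg]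
    obtain ⟨a, b, hab⟩ := hcop
    intro h0
    have h := congrArg (aeval y) hab
    rw [map_add, map_mul, map_mul, minpoly.aeval, h0, mul_zero, mul_zero, add_zero, map_one] at h
    exact zero_ne_one h
  have hf1 : v (aeval x f) ≤ v (algebraMap R L π) := by
    have h := hker (F - f * g) (by
      rw [Polynomial.map_sub, Polynomial.map_mul, hf, hg, hψ, sub_self])
    rwa [map_sub, hFx, zero_sub, Valuation.map_neg, map_mul, map_mul, hg1, mul_one] at h
  -- every non-unit `P(x)` of `R[x]` is a multiple of `f(x)` up to a multiple of `π`
  have hP (P : R[X]) (hP : v (aeval x P) < 1) : v (aeval x P) ≤ v (algebraMap R L π) := by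
    obtain ⟨q, hq⟩ := minpoly.dvd _ _ ((hval P).1 hP)
    obtain ⟨Q, rfl⟩ := map_surjective _ IsLocalRing.residue_surjective q
    have h := hker (P - f * Q) (by
      rw [Polynomial.map_sub, Polynomial.map_mul, hf, hq, sub_self])
    have h' : aeval x P = aeval x (P - f * Q) + aeval x f * aeval x Q := by
      rw [← map_mul, ← map_add, sub_add_cancel]
    rw [h']
    refine (v.map_add _ _).trans (max_le h ?_)
    rw [map_mul]
    exact (mul_le_of_le_one_right' (hle Q)).trans hf1
  have hmax : IsLocalRing.maximalIdeal V =
      Ideal.span {(⟨algebraMap R L π, hV.algebraMap_mem π⟩ : V)} := by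
    apply le_antisymm
    · intro w hw
      rw [V.valuation_lt_one_iff] at hw
      obtain ⟨P, Q, hQ, hw'⟩ := hV.exists_aeval_div_aeval hx hF hsep hFx w.2
      have hvw : v w = v (aeval x P) := by rw [hw', map_div₀, hQ, div_one]
      have hw1 : v w ≤ v (algebraMap R L π) := hvw ▸ hP P (hvw ▸ hw)
      obtain ⟨b, hb⟩ := (V.valuation_le_iff _ _).1 hw1
      exact Ideal.mem_span_singleton'.2 ⟨b, Subtype.ext hb⟩
    · rw [Ideal.span_singleton_le_iff_mem, V.valuation_lt_one_iff]
      exact (hV.valuation_lt_one_iff π).2 hπ.not_isUnit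
  obtain ⟨n, u, hu⟩ := IsDiscreteValuationRing.exists_units_eq_smul_zpow_of_irreducible
    ((IsDiscreteValuationRing.irreducible_iff_uniformizer _).2 hmax) hz
  refine ⟨algebraMap R E π ^ n, ?_⟩
  rw [hu, Units.smul_def, Algebra.smul_def, map_mul, map_zpow₀ (algebraMap E L),
    ← IsScalarTower.algebraMap_apply R E L]
  have h1 : v (algebraMap V L u) = 1 := V.valuation_unit u
  rw [h1, one_mul]
  rfl

end LiesAbove

/-- `a`, an element of the residue field of `R`, is the residue of `x` in `V`: an element `P(x)`
of `R[x]` is a non-unit of `V` if and only if `P` vanishes at `a` modulo the maximal ideal. -/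
def IsCenter {R L : Type*} [CommRing R] [IsLocalRing R] [Field L]
    [Algebra R L] (V : ValuationSubring L) (x : L) (a : IsLocalRing.ResidueField R) : Prop :=
  ∀ P : R[X], V.valuation (aeval x P) < 1 ↔ (P.map (IsLocalRing.residue R)).eval a = 0

theorem IsCenter.valuation_sub_lt_one_iff
    {a : IsLocalRing.ResidueField R} (ha : V.IsCenter x a) (r : R) :
    V.valuation (x - algebraMap R L r) < 1 ↔ a = IsLocalRing.residue R r := by
  have := ha (X - C r)
  rw [map_sub, aeval_X, aeval_C] at this
  rw [this, Polynomial.map_sub, map_X, map_C, eval_sub, eval_X, eval_C, sub_eq_zero]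

theorem IsCenter.unique {a b : IsLocalRing.ResidueField R}
    (ha : V.IsCenter x a) (hb : V.IsCenter x b) : a = b := by
  obtain ⟨r, rfl⟩ := IsLocalRing.residue_surjective b
  rw [← ha.valuation_sub_lt_one_iff, hb.valuation_sub_lt_one_iff]

namespace LiesAbove

theorem exists_residueMap_eq (hF : F.Monic) (hFx : aeval x F = 0)
    (hsplit : (F.map (IsLocalRing.residue R)).Splits) (hV : V.LiesAbove R E) :
    ∃ a, hV.residueMap a = IsLocalRing.residue V ⟨x, hV.mem_of_monic hF hFx⟩ := by
  refine hsplit.mem_range_of_isRoot (hF.map _).ne_zero ?_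
  rw [IsRoot, eval_map, ← hV.valuation_aeval_lt_one_iff, hFx, map_zero]
  exact zero_lt_one

/-- If the defining polynomial splits modulo the maximal ideal of `R`, the residue of `x` in a
valuation ring above `R` lies in the residue field of `R`. -/
theorem exists_isCenter (hF : F.Monic) (hFx : aeval x F = 0)
    (hsplit : (F.map (IsLocalRing.residue R)).Splits) (hV : V.LiesAbove R E) :
    ∃ a : IsLocalRing.ResidueField R, V.IsCenter x a := by
  obtain ⟨a, ha⟩ := hV.exists_residueMap_eq hF hFx hsplit
  refine ⟨a, fun P => ?_⟩
  rw [hV.valuation_aeval_lt_one_iff (hV.mem_of_monic hF hFx), ← ha, eval₂_at_apply, map_eq_zero]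

/-- A valuation ring above `R` is determined by the residue of `x`, as it is a localization of
`R[x]` at the ideal of the elements with residue zero. -/
theorem le_of_isCenter (hx : IntermediateField.adjoin E {x} = ⊤)
    (hF : F.Monic) (hsep : F.Separable) (hFx : aeval x F = 0) {W : ValuationSubring L}
    (hV : V.LiesAbove R E) (hW : W.LiesAbove R E) {a : IsLocalRing.ResidueField R}
    (ha : V.IsCenter x a) (ha' : W.IsCenter x a) : V ≤ W := by
  intro z hz
  obtain ⟨P, Q, hQ, rfl⟩ := hV.exists_aeval_div_aeval hx hF hsep hFx hz
  have hxV := hV.mem_of_monic hF hFx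
  have hxW := hW.mem_of_monic hF hFx
  rw [V.valuation_eq_one_iff_not_lt (hV.aeval_mem hxV Q), ha, ← ha',
    ← W.valuation_eq_one_iff_not_lt (hW.aeval_mem hxW Q)] at hQ
  rw [← W.valuation_le_one_iff, map_div₀, hQ, div_one, W.valuation_le_one_iff]
  exact hW.aeval_mem hxW P

/-- If the defining polynomial splits modulo the maximal ideal of `R`, the residue field does not
grow. -/
theorem exists_valuation_sub_lt_one (hx : IntermediateField.adjoin E {x} = ⊤)
    (hF : F.Monic) (hsep : F.Separable) (hFx : aeval x F = 0)
    (hsplit : (F.map (IsLocalRing.residue R)).Splits) (hV : V.LiesAbove R E)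
    {z : L} (hz : z ∈ V) : ∃ r : R, V.valuation (z - algebraMap R L r) < 1 := by
  have hxV := hV.mem_of_monic hF hFx
  obtain ⟨P, Q, hQ, hzPQ⟩ := hV.exists_aeval_div_aeval hx hF hsep hFx hz
  obtain ⟨a, ha⟩ := hV.exists_residueMap_eq hF hFx hsplit
  have hres (P : R[X]) : IsLocalRing.residue V ⟨aeval x P, hV.aeval_mem hxV P⟩ =
      hV.residueMap ((P.map (IsLocalRing.residue R)).eval a) := by
    rw [hV.residue_aeval hxV, ← ha, eval₂_at_apply]
  have hQ0 : aeval x Q ≠ 0 := fun h => by simp [h] at hQ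
  have hmul : (⟨z, hz⟩ : V) * ⟨aeval x Q, hV.aeval_mem hxV Q⟩ =
      ⟨aeval x P, hV.aeval_mem hxV P⟩ := by
    apply Subtype.ext
    change z * aeval x Q = aeval x P
    rw [hzPQ, div_mul_cancel₀ _ hQ0]
  have hQres : IsLocalRing.residue V ⟨aeval x Q, hV.aeval_mem hxV Q⟩ ≠ 0 := by
    rw [ne_eq, IsLocalRing.residue_eq_zero_iff, V.valuation_lt_one_iff]
    change ¬ V.valuation (aeval x Q) < 1
    rw [hQ]
    exact lt_irrefl _
  have h := congrArg (IsLocalRing.residue V) hmul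
  rw [map_mul, ← eq_div_iff hQres, hres, hres, ← map_div₀] at h
  obtain ⟨r, hr⟩ := IsLocalRing.residue_surjective
    (eval a (P.map (IsLocalRing.residue R)) / eval a (Q.map (IsLocalRing.residue R)))
  rw [← hr, hV.residueMap_residue, ← sub_eq_zero, ← map_sub, IsLocalRing.residue_eq_zero_iff,
    V.valuation_lt_one_iff] at h
  exact ⟨r, h⟩

end LiesAbove

end ValuationSubring

/-- A root of the minimal polynomial of `x` modulo the maximal ideal is the residue of `x` in some
valuation ring above `R`. -/
theorem exists_liesAbove_and_isCenter (hint : IsIntegral R x) {a : IsLocalRing.ResidueField R}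
    (ha : ((minpoly R x).map (IsLocalRing.residue R)).eval a = 0) :
    ∃ V : ValuationSubring L, V.LiesAbove R E ∧ V.IsCenter x a := by
  have := isTorsionFree_of_isScalarTower R E L
  have ha' := ha
  rw [eval_map] at ha'
  -- reduction of `R[x]` modulo the maximal ideal, with `x` sent to `a`
  let φ : Algebra.adjoin R {x} →+* IsLocalRing.ResidueField R :=
    (AdjoinRoot.lift (IsLocalRing.residue R) a ha').comp
      (minpoly.equivAdjoin hint).symm.toRingHom
  have hφ (P : R[X]) (h : aeval x P ∈ Algebra.adjoin R {x}) :
      φ ⟨aeval x P, h⟩ = (P.map (IsLocalRing.residue R)).eval a := by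
    have h1 : (minpoly.equivAdjoin hint).symm ⟨aeval x P, h⟩ = AdjoinRoot.mk _ P := by
      rw [AlgEquiv.symm_apply_eq]
      apply Subtype.ext
      simp [← aeval_def, ← Subalgebra.aeval_coe]
    change AdjoinRoot.lift _ _ ha' ((minpoly.equivAdjoin hint).symm ⟨aeval x P, h⟩) = _
    rw [h1, AdjoinRoot.lift_mk, eval_map]
  obtain ⟨V, hle, hV⟩ := Ideal.image_subset_nonunits_valuationSubring
    (A := (Algebra.adjoin R {x}).toSubring) (RingHom.ker φ) (RingHom.ker_ne_top φ)
  have hmem (P : R[X]) : aeval x P ∈ Algebra.adjoin R {x} := aeval_mem_adjoin_singleton R x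
  have hlt (P : R[X]) (hP : (P.map (IsLocalRing.residue R)).eval a = 0) :
      V.valuation (aeval x P) < 1 :=
    V.mem_nonunits_iff.1 (hV ⟨⟨aeval x P, hmem P⟩, (hφ P (hmem P)).trans hP, rfl⟩)
  have hcenter : V.IsCenter x a := by
    refine fun P => ⟨fun h => ?_, hlt P⟩
    by_contra h0
    obtain ⟨r, hr⟩ := IsLocalRing.residue_surjective (eval a (P.map (IsLocalRing.residue R)))⁻¹
    have h1 := hlt (P * C r - 1) (by simp [hr, h0])
    have hrV : V.valuation (algebraMap R L r) ≤ 1 :=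
      (V.valuation_le_one_iff _).2 (hle (Subalgebra.algebraMap_mem _ r))
    have h2 : V.valuation (aeval x P * algebraMap R L r) < 1 := by
      rw [map_mul]
      exact (mul_le_of_le_one_right' hrV).trans_lt h
    have h3 := V.valuation.map_sub_lt h2 h1
    simp at h3
  refine ⟨V, fun e => ⟨fun he => ?_, ?_⟩, hcenter⟩
  · rcases ValuationRing.isInteger_or_isInteger R e with h | ⟨r, hr⟩
    · exact h
    · by_cases hu : IsUnit r
      · obtain ⟨u, rfl⟩ := hu
        refine ⟨(u⁻¹ : Rˣ), ?_⟩
        have h := congrArg (algebraMap R E) u.mul_inv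
        rw [map_mul, map_one, hr] at h
        exact ((inv_mul_eq_one₀ (by rintro rfl; simp at h)).1 h).symm
      · have hr1 : V.valuation (algebraMap R L r) < 1 := by
          rw [← aeval_C x r]
          apply hlt
          rw [map_C, eval_C, IsLocalRing.residue_eq_zero_iff]
          exact hu
        rw [IsScalarTower.algebraMap_apply R E L, hr, map_inv₀, map_inv₀] at hr1
        rw [← V.valuation_le_one_iff] at he
        by_cases h0 : e = 0
        · exact ⟨0, by rw [h0, map_zero]⟩
        · exact absurd hr1 (not_lt.2 ((one_le_inv₀ (by rw [zero_lt_iff]; simpa using h0)).2 he))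
  · rintro ⟨r, rfl⟩
    rw [← IsScalarTower.algebraMap_apply R E L]
    exact hle (Subalgebra.algebraMap_mem _ r)

/-- If the defining polynomial splits into distinct linear factors modulo the maximal ideal of `R`,
there are exactly `[L : E]` valuation rings of `L` above `R`: they correspond to the roots of the
minimal polynomial of `x` modulo the maximal ideal. -/
theorem ncard_setOf_liesAbove (hx : IntermediateField.adjoin E {x} = ⊤)
    (hF : F.Monic) (hsep : F.Separable) (hFx : aeval x F = 0)
    (hsplit : (F.map (IsLocalRing.residue R)).Splits) :
    {V : ValuationSubring L | V.LiesAbove R E}.ncard = Module.finrank E L := by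
  have := isTorsionFree_of_isScalarTower R E L
  have hint : IsIntegral R x := ⟨F, hF, hFx⟩
  set f := (minpoly R x).map (IsLocalRing.residue R) with hf
  have hfm : f.Monic := (minpoly.monic hint).map _
  have hdvd : f ∣ F.map (IsLocalRing.residue R) :=
    Polynomial.map_dvd _ (minpoly.isIntegrallyClosed_dvd hint hFx)
  have hfsep : f.Separable := (hsep.map (f := IsLocalRing.residue R)).of_dvd hdvd
  have hfsplit : f.Splits := hsplit.of_dvd (hF.map _).ne_zero hdvd
  have hfinrank : Module.finrank E L = f.natDegree := by
    rw [hf, (minpoly.monic hint).natDegree_map, ← (minpoly.monic hint).natDegree_map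
      (algebraMap R E), ← minpoly.isIntegrallyClosed_eq_field_fractions E L (s := x) hint,
      Algebra.algebraMap_self, RingHom.id_apply,
      ← IntermediateField.adjoin.finrank hint.tower_top, hx, IntermediateField.finrank_top']
  have hroots : (f.rootSet (IsLocalRing.ResidueField R)).ncard = f.natDegree := by
    rw [← card_rootSet_eq_natDegree hfsep (K := IsLocalRing.ResidueField R)
      (by simpa using hfsplit), ← Nat.card_eq_fintype_card, Nat.card_coe_set_eq]
  rw [hfinrank, ← hroots]
  have hc (V : ValuationSubring L) (hV : V.LiesAbove R E) := hV.exists_isCenter hF hFx hsplit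
  choose c hc using hc
  refine Set.ncard_congr c (fun V hV => ?_) (fun V W hV hW h => ?_) (fun a ha => ?_)
  · have h := (hc V hV (minpoly R x)).1 (by
      rw [minpoly.aeval, map_zero]; exact zero_lt_one)
    rw [mem_rootSet]
    exact ⟨hfm.ne_zero, by rwa [coe_aeval_eq_eval]⟩
  · have h1 := hc V hV
    have h2 := hc W hW
    rw [h] at h1
    exact le_antisymm
      (ValuationSubring.LiesAbove.le_of_isCenter hx hF hsep hFx hV hW h1 h2)
      (ValuationSubring.LiesAbove.le_of_isCenter hx hF hsep hFx hW hV h2 h1)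
  · rw [mem_rootSet, coe_aeval_eq_eval] at ha
    obtain ⟨V, hV, hVa⟩ := exists_liesAbove_and_isCenter (E := E) hint ha.2
    exact ⟨V, hV, (hc V hV).unique hVa⟩

end Extension

/-! ### The trace polynomial and quasi-symmetric polynomials over finite fields -/

section FiniteField

variable {Fq K : Type*} [Field Fq] [Finite Fq] [Field K] [Algebra Fq K] {q n : ℕ}

theorem tracePoly_succ (R : Type*) [CommRing R] (n q : ℕ) :
    tracePoly R (n + 1) q = tracePoly R n q + X ^ q ^ n := Finset.sum_range_succ _ _

theorem natDegree_tracePoly_lt (R : Type*) [CommRing R] [Nontrivial R] (hq : 1 < q) (n : ℕ) :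
    (tracePoly R n q).natDegree < q ^ n := by
  induction n with
  | zero => simp [tracePoly]
  | succ n ih =>
    rw [tracePoly_succ]
    refine (natDegree_add_le _ _).trans_lt ?_
    rw [natDegree_X_pow, max_eq_right ih.le]
    exact Nat.pow_lt_pow_right hq n.lt_succ_self

theorem monic_tracePoly_sub_C {R : Type*} [CommRing R] [Nontrivial R] (hq : 1 < q) (hn : 0 < n)
    (c : R) : (tracePoly R n q - C c).Monic := by
  obtain ⟨m, rfl⟩ := Nat.exists_eq_succ_of_ne_zero hn.ne'
  rw [tracePoly_succ, add_sub_right_comm]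
  refine Monic.add_of_right (monic_X_pow _) (degree_lt_degree ?_)
  rw [natDegree_X_pow, natDegree_sub_C]
  exact natDegree_tracePoly_lt R hq m

theorem derivative_tracePoly_sub_C {R : Type*} [CommRing R] (hq : (q : R) = 0) (hn : 0 < n)
    (c : R) : derivative (tracePoly R n q - C c) = 1 := by
  obtain ⟨m, rfl⟩ := Nat.exists_eq_succ_of_ne_zero hn.ne'
  rw [tracePoly, Finset.sum_range_succ', derivative_sub, derivative_C, sub_zero, derivative_add,
    derivative_sum, Finset.sum_eq_zero, pow_zero, pow_one, derivative_X, zero_add]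
  intro j _
  rw [derivative_X_pow, Nat.cast_pow, hq, zero_pow (Nat.succ_ne_zero j), C_0, zero_mul]

theorem separable_tracePoly_sub_C {R : Type*} [CommRing R] (hq : (q : R) = 0) (hn : 0 < n)
    (c : R) : (tracePoly R n q - C c).Separable := by
  rw [separable_def, derivative_tracePoly_sub_C hq hn]
  exact isCoprime_one_right

theorem natCast_eq_zero_of_natCard_eq (hq : Nat.card Fq = q) (R : Type*) [CommRing R]
    [Algebra Fq R] :
    (q : R) = 0 := by
  have := Fintype.ofFinite Fq
  rw [← hq, Nat.card_eq_fintype_card, ← map_natCast (algebraMap Fq R),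
    FiniteField.cast_card_eq_zero, map_zero]

/-- If `b ^ q = b`, all the elements of trace `b` lie in the field with `q ^ n` elements: the
polynomial `Tr(T) - b` divides `(Tr(T) - b) ^ q - (Tr(T) - b) = T ^ q ^ n - T`. -/
theorem splits_tracePoly_sub_C [Finite K] (hq : Nat.card Fq = q) (hK : Nat.card K = q ^ n)
    {b : K} (hb : b ^ q = b) : (tracePoly K n q - C b).Splits := by
  have := Fintype.ofFinite Fq
  have := Fintype.ofFinite K
  have hq1 : 1 < q := hq ▸ Finite.one_lt_card
  have hK1 : 1 < q ^ n := hK ▸ Finite.one_lt_card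
  have hsum (m : ℕ) : tracePoly K m q ^ q = tracePoly K m q + X ^ q ^ m - X := by
    have h := map_sum (FiniteField.frobeniusAlgHom Fq K[X]) (fun j => X ^ q ^ j) (Finset.range m)
    simp only [FiniteField.coe_frobeniusAlgHom, ← Nat.card_eq_fintype_card, hq, ← pow_mul,
      ← pow_succ] at h
    rw [tracePoly, h, ← Finset.sum_range_succ, Finset.sum_range_succ']
    simp
  have hsub := map_sub (FiniteField.frobeniusAlgHom Fq K[X]) (tracePoly K n q) (C b)
  simp only [FiniteField.coe_frobeniusAlgHom, ← Nat.card_eq_fintype_card, hq] at hsub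
  have hdvd : tracePoly K n q - C b ∣ X ^ q ^ n - X := by
    have h : X ^ q ^ n - X = (tracePoly K n q - C b) ^ q - (tracePoly K n q - C b) := by
      rw [hsub, hsum, ← C_pow, hb]; ring
    rw [h]
    exact dvd_sub (dvd_pow_self _ (by lia)) dvd_rfl
  refine Splits.of_dvd ?_ (FiniteField.X_pow_card_sub_X_ne_zero K hK1) hdvd
  rw [splits_iff_card_roots, FiniteField.X_pow_card_sub_X_natDegree_eq _ hK1, ← hK,
    Nat.card_eq_fintype_card, FiniteField.roots_X_pow_card_sub_X]
  rfl

/-- The values of a quasi-symmetric polynomial on the field with `q ^ n` elements lie in the field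
with `q` elements: the Frobenius map permutes the arguments cyclically. -/
theorem IsNQQuasiSymmetric.aeval_pow_eq [Finite K] (hq : Nat.card Fq = q)
    (hK : Nat.card K = q ^ n) {g : Fq[X]} (hg : IsNQQuasiSymmetric n q g) (a : K) :
    aeval a g ^ q = aeval a g := by
  have := Fintype.ofFinite Fq
  have := Fintype.ofFinite K
  obtain ⟨f, hf, rfl⟩ := hg
  have hval : aeval a (MvPolynomial.aeval (fun j : Fin n => (X : Fq[X]) ^ q ^ (j : ℕ)) f) =
      MvPolynomial.aeval (fun j : Fin n => a ^ q ^ (j : ℕ)) f := by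
    rw [← AlgHom.comp_apply, MvPolynomial.comp_aeval]
    simp
  have hfrob : (MvPolynomial.aeval (fun j : Fin n => a ^ q ^ (j : ℕ)) f) ^ q =
      MvPolynomial.aeval (fun j : Fin n => a ^ q ^ ((j : ℕ) + 1)) f := by
    have h := DFunLike.congr_fun (MvPolynomial.comp_aeval (fun j : Fin n => a ^ q ^ (j : ℕ))
      (FiniteField.frobeniusAlgHom Fq K)) f
    simp only [AlgHom.comp_apply, FiniteField.coe_frobeniusAlgHom, ← Nat.card_eq_fintype_card, hq,
      ← pow_mul, ← pow_succ] at h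
    exact h
  have hrot : MvPolynomial.aeval (fun j : Fin n => a ^ q ^ (j : ℕ)) f =
      MvPolynomial.aeval (fun j : Fin n => a ^ q ^ ((j : ℕ) + 1)) f := by
    conv_lhs => rw [← hf, MvPolynomial.aeval_rename]
    congr 2
    funext j
    cases n with
    | zero => exact j.elim0
    | succ m =>
      rw [Function.comp_apply]
      by_cases hj : j = Fin.last m
      · subst hj
        have ha : a ^ q ^ (m + 1) = a := by
          rw [← hK, Nat.card_eq_fintype_card, FiniteField.pow_card]
        rw [finRotate_last, Fin.val_last, ha, Fin.val_zero, pow_zero, pow_one]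
      · rw [coe_finRotate_of_ne_last hj]
  rw [hval, hfrob, ← hrot]

end FiniteField

/-! ### Rational places and residues of rational functions -/

namespace ValuationSubring

variable {K E : Type*} [Field K] [Field E] [Algebra K E] {V : ValuationSubring E}

theorem valuation_algebraMap_eq_one (hV : ∀ a : K, algebraMap K E a ∈ V) {a : K} (ha : a ≠ 0) :
    V.valuation (algebraMap K E a) = 1 := by
  have h := map_one V.valuation
  rw [← map_one (algebraMap K E), ← mul_inv_cancel₀ ha, map_mul, map_mul] at h
  have h1 := (V.valuation_le_one_iff _).2 (hV a)
  have h2 := (V.valuation_le_one_iff _).2 (hV a⁻¹)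
  exact le_antisymm h1 (h ▸ mul_le_of_le_one_right' h2)

theorem aeval_mem (hV : ∀ a : K, algebraMap K E a ∈ V) {y : E} (hy : y ∈ V) (P : K[X]) :
    aeval y P ∈ V := by
  rw [aeval_eq_sum_range]
  refine sum_mem fun i _ => ?_
  rw [Algebra.smul_def]
  exact V.mul_mem _ _ (hV _) (pow_mem hy i)

theorem mem_of_valuation_sub_lt_one {y z : E} (hz : z ∈ V) (h : V.valuation (y - z) < 1) :
    y ∈ V := by
  rw [← sub_add_cancel y z]
  exact V.add_mem _ _ ((V.valuation_le_one_iff _).1 h.le) hz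

theorem valuation_aeval_sub_lt_one (hV : ∀ a : K, algebraMap K E a ∈ V) {y : E} {a : K}
    (hy : V.valuation (y - algebraMap K E a) < 1) (P : K[X]) :
    V.valuation (aeval y P - algebraMap K E (P.eval a)) < 1 := by
  obtain ⟨Q, hQ⟩ := X_sub_C_dvd_sub_C_eval (a := a) (p := P)
  have h := congrArg (aeval y) hQ
  rw [map_sub, aeval_C, map_mul, map_sub, aeval_X, aeval_C] at h
  rw [h, map_mul]
  exact (mul_le_of_le_one_right' ((V.valuation_le_one_iff _).2
    (V.aeval_mem hV (mem_of_valuation_sub_lt_one (hV a) hy) Q))).trans_lt hy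

/-- A rational function defined at `a` takes an element with residue `a` to an element with the
expected residue. -/
theorem valuation_aeval_div_aeval_sub_lt_one (hV : ∀ a : K, algebraMap K E a ∈ V) {y : E} {a : K}
    (hy : V.valuation (y - algebraMap K E a) < 1) (G : K[X]) {H : K[X]} (hH : H.eval a ≠ 0) :
    V.valuation (aeval y G / aeval y H - algebraMap K E (G.eval a / H.eval a)) < 1 := by
  have hyV := mem_of_valuation_sub_lt_one (hV a) hy
  have hG := V.valuation_aeval_sub_lt_one hV hy G
  have hHy := V.valuation_aeval_sub_lt_one hV hy H
  have h1 := V.valuation_algebraMap_eq_one hV hH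
  have hH1 : V.valuation (aeval y H) = 1 := by
    have h := V.valuation.map_add_eq_of_lt_left (h1.symm ▸ hHy)
    rwa [add_sub_cancel, h1] at h
  have hH0 : aeval y H ≠ 0 := fun h => by simp [h] at hH1
  have hHa0 : algebraMap K E (H.eval a) ≠ 0 := by simpa using hH
  have heq : aeval y G / aeval y H - algebraMap K E (G.eval a / H.eval a) =
      ((aeval y G - algebraMap K E (G.eval a)) * algebraMap K E (H.eval a) -
        (aeval y H - algebraMap K E (H.eval a)) * algebraMap K E (G.eval a)) /
          (aeval y H * algebraMap K E (H.eval a)) := by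
    rw [map_div₀]; field_simp; ring
  rw [heq, map_div₀, map_mul _ (aeval y H), hH1, h1, mul_one, div_one]
  refine V.valuation.map_sub_lt ?_ ?_
  · rwa [map_mul, h1, mul_one]
  · rw [map_mul]
    exact (mul_le_of_le_one_right' ((V.valuation_le_one_iff _).2 (hV _))).trans_lt hHy

/-- At a pole of `y`, the quotient `g(y)/h(y)` with `deg g ≤ deg h` has as residue the quotient of
the coefficients of degree `deg h`. -/
theorem valuation_aeval_div_aeval_sub_lt_one_of_notMem (hV : ∀ a : K, algebraMap K E a ∈ V) {y : E}
    (hy : y ∉ V) {G H : K[X]} (hH : H ≠ 0) (hdeg : G.natDegree ≤ H.natDegree) :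
    V.valuation (aeval y G / aeval y H -
      algebraMap K E (G.coeff H.natDegree / H.leadingCoeff)) < 1 := by
  have hy0 : y ≠ 0 := by rintro rfl; exact hy V.zero_mem
  have hinv : V.valuation (y⁻¹ - algebraMap K E 0) < 1 := by
    rw [map_zero, sub_zero, map_inv₀]
    exact inv_lt_one_of_one_lt₀ (not_le.1 (mt (V.valuation_le_one_iff y).1 hy))
  let := invertibleOfNonzero hy0
  have hrev (P : K[X]) (hP : P.natDegree ≤ H.natDegree) :
      aeval y P = aeval y⁻¹ (P.reflect H.natDegree) * y ^ H.natDegree := by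
    rw [aeval_def, aeval_def, ← eval₂_reflect_mul_pow _ y _ P hP, invOf_eq_inv]
  have hcoeff (P : K[X]) : (P.reflect H.natDegree).eval 0 = P.coeff H.natDegree := by
    rw [← coeff_zero_eq_eval_zero, coeff_reflect, revAt_zero]
  have h := V.valuation_aeval_div_aeval_sub_lt_one hV hinv (G.reflect H.natDegree)
    (H := H.reflect H.natDegree) (by rw [hcoeff]; simpa using hH)
  rwa [hcoeff, hcoeff, ← mul_div_mul_right _ _ (pow_ne_zero H.natDegree hy0), ← hrev G hdeg,
    ← hrev H le_rfl] at h

theorem aeval_div_aeval_mem_of_notMem (hV : ∀ a : K, algebraMap K E a ∈ V) {y : E}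
    (hy : y ∉ V) {G H : K[X]} (hH : H ≠ 0) (hdeg : G.natDegree ≤ H.natDegree) :
    aeval y G / aeval y H ∈ V :=
  mem_of_valuation_sub_lt_one (hV _)
    (V.valuation_aeval_div_aeval_sub_lt_one_of_notMem hV hy hH hdeg)

end ValuationSubring

namespace Place

variable {K E : Type*} [Field K] [Field E] [Algebra K E] (P : Place K E)

/-- A place is rational if and only if every element of its valuation ring has a residue in `K`. -/
theorem isRational_iff : P.IsRational ↔
    ∀ z ∈ P.ring, ∃ a : K, P.ring.valuation (z - algebraMap K E a) < 1 := by
  rw [IsRational, degree, finrank_eq_one_iff_of_nonzero' 1 one_ne_zero]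
  have key (z : P.ring) (a : K) : a • (1 : IsLocalRing.ResidueField P.ring) =
      IsLocalRing.residue P.ring z ↔ P.ring.valuation ((z : E) - algebraMap K E a) < 1 := by
    have h : a • (1 : IsLocalRing.ResidueField P.ring) =
        IsLocalRing.residue P.ring ⟨algebraMap K E a, P.algebraMap_mem a⟩ := by
      rw [Algebra.smul_def, mul_one]; rfl
    rw [h, eq_comm, ← sub_eq_zero, ← map_sub, IsLocalRing.residue_eq_zero_iff,
      ValuationSubring.valuation_lt_one_iff]
    rfl
  constructor
  · intro h z hz
    obtain ⟨a, ha⟩ := h (IsLocalRing.residue P.ring ⟨z, hz⟩)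
    exact ⟨a, (key _ a).1 ha⟩
  · intro h w
    obtain ⟨z, rfl⟩ := IsLocalRing.residue_surjective w
    obtain ⟨a, ha⟩ := h z z.2
    exact ⟨a, (key _ a).2 ha⟩

theorem ring_injective : Function.Injective (ring : Place K E → ValuationSubring E) := by
  rintro ⟨V, _, _⟩ ⟨W, _, _⟩ h
  congr

theorem isDiscreteValuationRing_of_mem {y : E} (hy : Transcendental K y)
    (htop : IntermediateField.adjoin K {y} = ⊤) (hyP : y ∈ P.ring) :
    IsDiscreteValuationRing P.ring := by
  let : Algebra K[X] E := (aeval y).toAlgebra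
  have hinj : Function.Injective (algebraMap K[X] E) := transcendental_iff_injective.1 hy
  have : FaithfulSMul K[X] E := (faithfulSMul_iff_algebraMap_injective _ _).2 hinj
  have : IsFractionRing K[X] E := IsFractionRing.of_field _ _ fun z =>
    (IntermediateField.mem_adjoin_simple_iff K z).1 (htop ▸ IntermediateField.mem_top)
  exact (P.ring.isDiscreteValuationRing_and_exists_div (A := K[X])
    (P.ring.aeval_mem P.algebraMap_mem hyP) P.ne_top).1

/-- The valuation rings of the places of a rational function field are discrete. -/
theorem isDiscreteValuationRing_of_transcendental {y : E} (hy : Transcendental K y)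
    (htop : IntermediateField.adjoin K {y} = ⊤) : IsDiscreteValuationRing P.ring := by
  rcases P.ring.mem_or_inv_mem y with h | h
  · exact P.isDiscreteValuationRing_of_mem hy htop h
  · refine P.isDiscreteValuationRing_of_mem (y := y⁻¹) (fun h => hy (inv_inv y ▸ h.inv)) ?_ h
    rw [← top_le_iff, ← htop, IntermediateField.adjoin_simple_le_iff]
    have := IntermediateField.mem_adjoin_simple_self K y⁻¹
    simpa using inv_mem this

end Place

/-! ### Places in an extension of function fields -/

namespace Place

theorem finrank_fieldRange {K E L : Type*} [Field K] [Field E] [Field L] [Algebra K E] [Algebra K L]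
    [Algebra E L] [IsScalarTower K E L] :
    Module.finrank (IsScalarTower.toAlgHom K E L).fieldRange L = Module.finrank E L := by
  refine (Algebra.finrank_eq_of_equiv_equiv
    (IsScalarTower.toAlgHom K E L).equivFieldRange.toRingEquiv (RingEquiv.refl L) ?_).symm
  ext e
  rfl

variable {K E L : Type*} [Field K] [Field E] [Field L] [Algebra K E] [Algebra K L]

/-- The restriction of a place of `L` to `E`, provided that its valuation ring does not contain
`E`. -/
noncomputable def restrict (φ : E →ₐ[K] L) (P : Place K L)
    (h : P.ring.comap φ.toRingHom ≠ ⊤) : Place K E where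
  ring := P.ring.comap φ.toRingHom
  algebraMap_mem a := by
    rw [ValuationSubring.mem_comap]
    exact (φ.commutes a).symm ▸ P.algebraMap_mem a
  ne_top := h

theorem mem_above_iff_ring {φ : E →ₐ[K] L} {P : Place K E} {P' : Place K L} :
    P' ∈ P.above φ ↔ P'.ring.comap φ.toRingHom = P.ring := Iff.rfl

variable [Algebra E L] [IsScalarTower K E L] {P : Place K E} {P' : Place K L}

section Transitivity

variable {M : Type*} [Field M] [Algebra K M] [Algebra L M] [Algebra E M] [IsScalarTower K L M]
  [IsScalarTower K E M] [IsScalarTower E L M]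

theorem mem_above_iff_exists {P : Place K E} {Q : Place K M} :
    Q ∈ P.above (IsScalarTower.toAlgHom K E M) ↔
      ∃ Q' ∈ P.above (IsScalarTower.toAlgHom K E L),
        Q ∈ Q'.above (IsScalarTower.toAlgHom K L M) := by
  have hcomap : Q.ring.comap (IsScalarTower.toAlgHom K E M).toRingHom =
      (Q.ring.comap (IsScalarTower.toAlgHom K L M).toRingHom).comap
        (IsScalarTower.toAlgHom K E L).toRingHom := by
    rw [ValuationSubring.comap_comap]
    congr 1
    exact IsScalarTower.algebraMap_eq E L M
  simp only [mem_above_iff_ring]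
  rw [hcomap]
  constructor
  · intro h
    refine ⟨Q.restrict (IsScalarTower.toAlgHom K L M) (fun htop => P.ne_top ?_), h, rfl⟩
    rw [← h, htop]
    rfl
  · rintro ⟨Q', h1, h2⟩
    rw [h2, h1]

/-- Complete splitting is transitive. -/
theorem SplitsCompletely.trans [FiniteDimensional E L] [FiniteDimensional L M] {P : Place K E}
    (hP : P.SplitsCompletely (IsScalarTower.toAlgHom K E L))
    (hQ : ∀ Q ∈ P.above (IsScalarTower.toAlgHom K E L),
      Q.SplitsCompletely (IsScalarTower.toAlgHom K L M)) :
    P.SplitsCompletely (IsScalarTower.toAlgHom K E M) := by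
  unfold SplitsCompletely at hP hQ ⊢
  rw [finrank_fieldRange] at hP ⊢
  simp only [finrank_fieldRange] at hQ
  have hfin : (P.above (IsScalarTower.toAlgHom K E L)).Finite :=
    Set.finite_of_ncard_pos (hP ▸ Module.finrank_pos)
  have hunion : P.above (IsScalarTower.toAlgHom K E M) =
      ⋃ Q ∈ P.above (IsScalarTower.toAlgHom K E L), Q.above (IsScalarTower.toAlgHom K L M) := by
    ext Q
    simp only [Set.mem_iUnion, exists_prop]
    exact mem_above_iff_exists
  rw [hunion, hfin.ncard_biUnion
    (fun Q hQ' => Set.finite_of_ncard_pos ((hQ Q hQ').symm ▸ Module.finrank_pos)),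
    finsum_mem_congr rfl hQ, finsum_mem_eq_finite_toFinset_sum _ hfin, Finset.sum_const,
    ← Set.ncard_eq_toFinset_card _ hfin, hP, smul_eq_mul, Module.finrank_mul_finrank]
  intro Q _ Q' _ hne
  rw [Function.onFun, Set.disjoint_left]
  intro T hT hT'
  exact hne (ring_injective (hT.symm.trans hT'))

end Transitivity

theorem mem_above_iff_liesAbove :
    P' ∈ P.above (IsScalarTower.toAlgHom K E L) ↔ P'.ring.LiesAbove P.ring E := by
  have hrange (e : E) : e ∈ Set.range (algebraMap P.ring E) ↔ e ∈ P.ring :=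
    ⟨by rintro ⟨r, rfl⟩; exact r.2, fun h => ⟨⟨e, h⟩, rfl⟩⟩
  simp only [ValuationSubring.LiesAbove, hrange]
  rw [mem_above_iff_ring, SetLike.ext_iff]
  rfl

theorem comap_ne_top [Algebra.IsAlgebraic E L] (P' : Place K L) :
    P'.ring.comap (IsScalarTower.toAlgHom K E L).toRingHom ≠ ⊤ := by
  intro h
  refine P'.ne_top (top_le_iff.1 fun z _ => P'.ring.mem_of_isIntegral (R := E) (fun e => ?_)
    (Algebra.IsAlgebraic.isAlgebraic z).isIntegral)
  have he : e ∈ P'.ring.comap (IsScalarTower.toAlgHom K E L).toRingHom :=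
    h ▸ ValuationSubring.mem_top e
  exact he

/-- If the valuation rings of the places of `E` are discrete, so are those of the places of a finite
separable extension `L`. -/
theorem isDiscreteValuationRing_of_forall [FiniteDimensional E L] [Algebra.IsSeparable E L]
    (h : ∀ P : Place K E, IsDiscreteValuationRing P.ring) (P' : Place K L) :
    IsDiscreteValuationRing P'.ring := by
  let P : Place K E := P'.restrict (IsScalarTower.toAlgHom K E L) P'.comap_ne_top
  have := h P
  have hP : P'.ring.LiesAbove P.ring E := mem_above_iff_liesAbove.1 rfl
  exact hP.isDiscreteValuationRing_and_exists_div.1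

theorem ncard_above_eq (P : Place K E) : (P.above (IsScalarTower.toAlgHom K E L)).ncard =
    {V : ValuationSubring L | V.LiesAbove P.ring E}.ncard := by
  rw [← Set.ncard_image_of_injective _ ring_injective]
  congr 1
  ext V
  constructor
  · rintro ⟨P', hP', rfl⟩
    exact mem_above_iff_liesAbove.1 hP'
  · intro hV
    have hmem (e : E) (he : e ∈ P.ring) : algebraMap E L e ∈ V := (hV e).2 ⟨⟨e, he⟩, rfl⟩
    refine ⟨⟨V, fun a => ?_, ?_⟩, mem_above_iff_liesAbove.2 hV, rfl⟩
    · rw [IsScalarTower.algebraMap_apply K E L]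
      exact hmem _ (P.algebraMap_mem a)
    · rintro rfl
      refine P.ne_top (top_le_iff.1 fun e _ => ?_)
      obtain ⟨r, rfl⟩ := (hV e).1 (ValuationSubring.mem_top _)
      exact r.2

theorem ramificationIdx_eq_one
    (h : ∀ z : L, z ≠ 0 → ∃ e : E, P'.ring.valuation z = P'.ring.valuation (algebraMap E L e)) :
    P'.ramificationIdx (IsScalarTower.toAlgHom K E L) = 1 := by
  rw [ramificationIdx, Subgroup.index_eq_one, ← top_le_iff]
  intro u _
  obtain ⟨e, he⟩ := h u u.ne_zero
  have he0 : e ≠ 0 := by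
    rintro rfl
    simp at he
  let w : Lˣ := Units.map (IsScalarTower.toAlgHom K E L : E →* L) (Units.mk0 e he0)
  have hw : (w : L) = algebraMap E L e := rfl
  rw [← inv_mul_cancel_right u w]
  refine Subgroup.mul_mem_sup ?_ ⟨_, rfl⟩
  rw [ValuationSubring.mem_unitGroup_iff, Units.val_mul, map_mul, Units.val_inv_eq_inv_val,
    map_inv₀, hw, he, mul_inv_cancel₀]
  rw [← he]
  simp

end Place

/-! ### One step of the tower -/

section TraceStep

variable {K E L : Type*} [Field K] [Field E] [Field L] [Algebra K E] [Algebra K L]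
  [Algebra E L] [IsScalarTower K E L] {q n : ℕ} {x : L} {c : E}

theorem aeval_tracePoly_sub_C {R L : Type*} [CommRing R] [CommRing L] [Algebra R L] {x : L} {c : R}
    (h : ∑ j ∈ Finset.range n, x ^ q ^ j = algebraMap R L c) :
    aeval x (tracePoly R n q - C c) = 0 := by
  rw [map_sub, aeval_C, tracePoly, map_sum, ← h, sub_eq_zero]
  simp

theorem finiteDimensional_and_isSeparable_of_trace_eq {K E L : Type*} [Field K] [Field E] [Field L]
    [Algebra K E] [Algebra E L] {x : L} {c : E} (hq : 1 < q) (hq0 : (q : K) = 0)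
    (hn : 0 < n) (hx : IntermediateField.adjoin E {x} = ⊤)
    (h : ∑ j ∈ Finset.range n, x ^ q ^ j = algebraMap E L c) :
    FiniteDimensional E L ∧ Algebra.IsSeparable E L := by
  have hqE : (q : E) = 0 := by rw [← map_natCast (algebraMap K E), hq0, map_zero]
  exact finiteDimensional_and_isSeparable_of_aeval_eq_zero (R := E) hx
    (monic_tracePoly_sub_C hq hn c) (separable_tracePoly_sub_C hqE hn c) (aeval_tracePoly_sub_C h)

namespace Place

variable {P : Place K E} {P' : Place K L}

theorem natCast_ring_eq_zero (hq0 : (q : K) = 0) : (q : P.ring) = 0 := by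
  rw [← map_natCast (algebraMap K P.ring), hq0, map_zero]

/-- A place where `c` is regular is unramified in the extension given by `Tr(x) = c`. -/
theorem ramificationIdx_eq_one_of_mem [IsDiscreteValuationRing P.ring] (hq : 1 < q)
    (hq0 : (q : K) = 0) (hn : 0 < n) (hx : IntermediateField.adjoin E {x} = ⊤)
    (h : ∑ j ∈ Finset.range n, x ^ q ^ j = algebraMap E L c) (hc : c ∈ P.ring)
    (hP' : P' ∈ P.above (IsScalarTower.toAlgHom K E L)) :
    P'.ramificationIdx (IsScalarTower.toAlgHom K E L) = 1 :=
  ramificationIdx_eq_one fun _ hz =>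
    (mem_above_iff_liesAbove.1 hP').exists_valuation_eq hx
      (monic_tracePoly_sub_C hq hn (⟨c, hc⟩ : P.ring))
      (separable_tracePoly_sub_C (natCast_ring_eq_zero hq0) hn _) (aeval_tracePoly_sub_C h) hz

/-- A rational place where `c` has a residue `b` in the field with `q` elements splits completely
in the extension given by `Tr(x) = c`, into rational places. -/
theorem splitsCompletely_and_isRational [IsDiscreteValuationRing P.ring] (hq : 1 < q)
    (hq0 : (q : K) = 0) (hn : 0 < n) (hx : IntermediateField.adjoin E {x} = ⊤)
    (h : ∑ j ∈ Finset.range n, x ^ q ^ j = algebraMap E L c) (hP : P.IsRational) {b : K}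
    (hb : P.ring.valuation (c - algebraMap K E b) < 1)
    (hsplit : (tracePoly K n q - C b).Splits) :
    P.SplitsCompletely (IsScalarTower.toAlgHom K E L) ∧
      ∀ P' ∈ P.above (IsScalarTower.toAlgHom K E L), P'.IsRational := by
  have hc : c ∈ P.ring := ValuationSubring.mem_of_valuation_sub_lt_one (P.algebraMap_mem b) hb
  have hF := monic_tracePoly_sub_C hq hn (⟨c, hc⟩ : P.ring)
  have hsep := separable_tracePoly_sub_C (natCast_ring_eq_zero (P := P) hq0) hn
    (⟨c, hc⟩ : P.ring)
  have hFx := aeval_tracePoly_sub_C (c := (⟨c, hc⟩ : P.ring)) h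
  have hres : IsLocalRing.residue P.ring ⟨c, hc⟩ =
      algebraMap K (IsLocalRing.ResidueField P.ring) b := by
    change _ = IsLocalRing.residue P.ring ⟨algebraMap K E b, P.algebraMap_mem b⟩
    rw [← sub_eq_zero, ← map_sub, IsLocalRing.residue_eq_zero_iff,
      ValuationSubring.valuation_lt_one_iff]
    exact hb
  have hsplit' : ((tracePoly P.ring n q - C (⟨c, hc⟩ : P.ring)).map
      (IsLocalRing.residue P.ring)).Splits := by
    have h1 := hsplit.map (algebraMap K (IsLocalRing.ResidueField P.ring))
    convert h1 using 1
    simp [tracePoly, Polynomial.map_sum, hres]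
  constructor
  · rw [SplitsCompletely, finrank_fieldRange, ncard_above_eq]
    exact ncard_setOf_liesAbove hx hF hsep hFx hsplit'
  · intro P' hP'
    rw [mem_above_iff_liesAbove] at hP'
    rw [isRational_iff] at hP ⊢
    intro z hz
    obtain ⟨r, hr⟩ := hP'.exists_valuation_sub_lt_one hx hF hsep hFx hsplit' hz
    obtain ⟨a, ha⟩ := hP r r.2
    refine ⟨a, ?_⟩
    have h2 : P'.ring.valuation
        (algebraMap P.ring L (r - ⟨algebraMap K E a, P.algebraMap_mem a⟩)) < 1 := by
      rw [hP'.valuation_lt_one_iff, ValuationSubring.valuation_lt_one_iff]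
      exact ha
    have h3 : algebraMap P.ring L ⟨algebraMap K E a, P.algebraMap_mem a⟩ = algebraMap K L a := by
      rw [IsScalarTower.algebraMap_apply K E L]; rfl
    rw [map_sub, h3] at h2
    have h4 := P'.ring.valuation.map_add_lt hr h2
    rwa [sub_add_sub_cancel] at h4

/-- At a rational place, a quotient `g(y)/h(y)` of quasi-symmetric polynomials, with `h` free of
zeros and `deg g ≤ deg h`, has a residue in the field with `q` elements. -/
theorem exists_residue_pow_eq {Fq : Type*} [Field Fq] [Finite Fq] [Finite K] [Algebra Fq K]
    (hq : Nat.card Fq = q) (hK : Nat.card K = q ^ n) {g h : Fq[X]}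
    (hg : IsNQQuasiSymmetric n q g) (hh : IsNQQuasiSymmetric n q h)
    (hh0 : ∀ a : K, aeval a h ≠ 0) (hdeg : g.natDegree ≤ h.natDegree) (hP : P.IsRational) (y : E) :
    ∃ b : K, b ^ q = b ∧ P.ring.valuation (aeval y (g.map (algebraMap Fq K)) /
      aeval y (h.map (algebraMap Fq K)) - algebraMap K E b) < 1 := by
  rw [isRational_iff] at hP
  by_cases hy : y ∈ P.ring
  · obtain ⟨a, ha⟩ := hP y hy
    have heval (f : Fq[X]) : (f.map (algebraMap Fq K)).eval a = aeval a f := eval_map_algebraMap _ _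
    refine ⟨_, ?_, ValuationSubring.valuation_aeval_div_aeval_sub_lt_one P.algebraMap_mem ha
      (g.map (algebraMap Fq K)) (H := h.map (algebraMap Fq K)) (by rw [heval]; exact hh0 a)⟩
    rw [heval, heval, div_pow, hg.aeval_pow_eq hq hK, hh.aeval_pow_eq hq hK]
  · have hne : h ≠ 0 := by
      rintro rfl
      exact hh0 0 (map_zero _)
    refine ⟨_, ?_, P.ring.valuation_aeval_div_aeval_sub_lt_one_of_notMem P.algebraMap_mem hy
      (G := g.map (algebraMap Fq K)) (Polynomial.map_ne_zero hne) (by simpa using hdeg)⟩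
    have := Fintype.ofFinite Fq
    rw [natDegree_map, leadingCoeff_map, coeff_map, ← map_div₀, ← map_pow, ← hq,
      Nat.card_eq_fintype_card, FiniteField.pow_card]

end Place

end TraceStep

/-! ### The tower -/

section Tower

variable {K Ω : Type*} [Field K] [Field Ω] [Algebra K Ω] (x : ℕ → Ω) {q n i : ℕ}

/-- The generator `x_i` as an element of `F_i`. -/
noncomputable def towerGen (K : Type*) {Ω : Type*} [Field K] [Field Ω] [Algebra K Ω] (x : ℕ → Ω)
    {i : ℕ} (hi : 1 ≤ i) : towerField K x i :=
  ⟨x i, IntermediateField.subset_adjoin K _ ⟨i, ⟨hi, le_rfl⟩, rfl⟩⟩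

theorem adjoin_towerGen_one : IntermediateField.adjoin K {towerGen K x le_rfl} = ⊤ := by
  rw [← top_le_iff]
  intro z _
  have h : (z : Ω) ∈ IntermediateField.adjoin K {x 1} := by
    have h : (z : Ω) ∈ IntermediateField.adjoin K (x '' Set.Icc 1 1) := z.2
    rwa [Set.Icc_self, Set.image_singleton] at h
  have h' : IntermediateField.adjoin K {x 1} =
      (IntermediateField.adjoin K {towerGen K x le_rfl}).map (towerField K x 1).val := by
    rw [IntermediateField.adjoin_map, Set.image_singleton]
    rfl
  rw [h'] at h
  obtain ⟨w, hw, hwz⟩ := h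
  rwa [← Subtype.ext hwz]

theorem transcendental_towerGen_one (hx1 : Transcendental K (x 1)) :
    Transcendental K (towerGen K x le_rfl) := fun h =>
  hx1 (h.algHom (towerField K x 1).val)

/-- `F_j` as an extension of `F_i` for `i ≤ j`. -/
@[reducible] noncomputable def towerAlgebra (K : Type*) {Ω : Type*} [Field K] [Field Ω]
    [Algebra K Ω] (x : ℕ → Ω) {i j : ℕ} (h : i ≤ j) :
    Algebra (towerField K x i) (towerField K x j) :=
  (towerIncl K x h).toRingHom.toAlgebra

theorem isScalarTower_tower {i j : ℕ} (h : i ≤ j) :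
    letI := towerAlgebra K x h
    IsScalarTower K (towerField K x i) (towerField K x j) :=
  letI := towerAlgebra K x h
  IsScalarTower.of_algebraMap_eq' rfl

theorem adjoin_towerGen_succ (hi : 1 ≤ i) :
    letI := towerAlgebra K x (Nat.le_add_right i 1)
    IntermediateField.adjoin (towerField K x i) {towerGen K x (Nat.le_succ_of_le hi)} = ⊤ := by
  let := towerAlgebra K x (Nat.le_add_right i 1)
  have := isScalarTower_tower (K := K) x (Nat.le_add_right i 1)
  have key (w : Ω) (hw : w ∈ IntermediateField.adjoin K (x '' Set.Icc 1 (i + 1))) :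
      (⟨w, hw⟩ : towerField K x (i + 1)) ∈ IntermediateField.adjoin (towerField K x i)
        {towerGen K x (Nat.le_succ_of_le hi)} := by
    induction hw using IntermediateField.adjoin_induction with
    | mem w hw =>
      obtain ⟨j, ⟨hj1, hj⟩, rfl⟩ := hw
      rcases Nat.le_succ_iff.1 hj with hj | rfl
      · exact IntermediateField.algebraMap_mem _ (⟨x j, IntermediateField.subset_adjoin K _
          ⟨j, ⟨hj1, hj⟩, rfl⟩⟩ : towerField K x i)
      · exact IntermediateField.mem_adjoin_simple_self _ _
    | algebraMap a =>
      exact IntermediateField.algebraMap_mem _ (algebraMap K (towerField K x i) a)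
    | add _ _ _ _ h1 h2 => exact add_mem h1 h2
    | inv _ _ h => exact inv_mem h
    | mul _ _ _ _ h1 h2 => exact mul_mem h1 h2
  exact top_le_iff.1 fun z _ => key z.1 z.2

theorem sum_towerGen_pow_eq {g h : K[X]} (hi : 1 ≤ i)
    (hx : ∑ j ∈ Finset.range n, x (i + 1) ^ q ^ j = aeval (x i) g / aeval (x i) h) :
    letI := towerAlgebra K x (Nat.le_add_right i 1)
    ∑ j ∈ Finset.range n, towerGen K x (Nat.le_succ_of_le hi) ^ q ^ j =
      algebraMap (towerField K x i) (towerField K x (i + 1))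
        (aeval (towerGen K x hi) g / aeval (towerGen K x hi) h) := by
  let := towerAlgebra K x (Nat.le_add_right i 1)
  apply (towerField K x (i + 1)).val.injective
  rw [map_sum]
  have hval (f : K[X]) : aeval (x i) f = (towerField K x i).val (aeval (towerGen K x hi) f) := by
    rw [← aeval_algHom_apply]; rfl
  rw [hval, hval, ← map_div₀] at hx
  simp only [map_pow]
  exact hx

/-- The inclusions of a chain of intermediate fields form a scalar tower. The fields are arbitrary
here because the definitional check behind `rfl` is very expensive for explicit adjunctions. -/
theorem isScalarTower_inclusion
    {S T U : IntermediateField K Ω} (hST : S ≤ T) (hTU : T ≤ U) :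
    letI := (IntermediateField.inclusion hST).toRingHom.toAlgebra
    letI := (IntermediateField.inclusion hTU).toRingHom.toAlgebra
    letI := (IntermediateField.inclusion (hST.trans hTU)).toRingHom.toAlgebra
    IsScalarTower S T U :=
  let := (IntermediateField.inclusion hST).toRingHom.toAlgebra
  let := (IntermediateField.inclusion hTU).toRingHom.toAlgebra
  let := (IntermediateField.inclusion (hST.trans hTU)).toRingHom.toAlgebra
  IsScalarTower.of_algebraMap_eq fun _ => rfl

theorem isScalarTower_towerField {i j k : ℕ} (hij : i ≤ j) (hjk : j ≤ k) :
    letI := towerAlgebra K x hij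
    letI := towerAlgebra K x hjk
    letI := towerAlgebra K x (hij.trans hjk)
    IsScalarTower (towerField K x i) (towerField K x j) (towerField K x k) :=
  isScalarTower_inclusion (towerField_mono K x hij) (towerField_mono K x hjk)

theorem toAlgHom_eq_towerIncl {i j : ℕ} (h : i ≤ j) :
    letI := towerAlgebra K x h
    haveI := isScalarTower_tower (K := K) x h
    IsScalarTower.toAlgHom K (towerField K x i) (towerField K x j) = towerIncl K x h :=
  rfl

theorem splitsCompletely_towerIncl_refl (P : Place K (towerField K x i)) :
    P.SplitsCompletely (towerIncl K x le_rfl) ∧ ∀ Q ∈ P.above (towerIncl K x le_rfl), Q = P := by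
  have habove : P.above (towerIncl K x le_rfl) = {P} := by
    ext Q
    rw [Set.mem_singleton_iff, ← Place.ring_injective.eq_iff, Place.mem_above_iff_ring]
    rfl
  refine ⟨?_, fun Q hQ => by rwa [habove] at hQ⟩
  have h : Module.finrank (towerIncl K x (le_refl i)).fieldRange (towerField K x i) = 1 :=
    Place.finrank_fieldRange.trans (Module.finrank_self _)
  rw [Place.SplitsCompletely, habove, h, Set.ncard_singleton]

variable {x}

theorem finiteDimensional_and_isSeparable_tower_step {g h : K[X]} (hq1 : 1 < q)
    (hq0 : (q : K) = 0) (hn : 0 < n) (hi : 1 ≤ i)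
    (hx : ∑ j ∈ Finset.range n, x (i + 1) ^ q ^ j = aeval (x i) g / aeval (x i) h) :
    letI := towerAlgebra K x (Nat.le_add_right i 1)
    FiniteDimensional (towerField K x i) (towerField K x (i + 1)) ∧
      Algebra.IsSeparable (towerField K x i) (towerField K x (i + 1)) := by
  let := towerAlgebra K x (Nat.le_add_right i 1)
  exact finiteDimensional_and_isSeparable_of_trace_eq (K := K) hq1 hq0 hn
    (adjoin_towerGen_succ x hi) (sum_towerGen_pow_eq x hi hx)

/-- The valuation rings of the places of the fields `F_i` are discrete. -/
theorem isDiscreteValuationRing_place_tower {g h : K[X]} (hq1 : 1 < q)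
    (hq0 : (q : K) = 0) (hn : 0 < n) (hx1 : Transcendental K (x 1))
    (hx : ∀ i, 1 ≤ i →
      ∑ j ∈ Finset.range n, x (i + 1) ^ q ^ j = aeval (x i) g / aeval (x i) h) (hi : 1 ≤ i) :
    ∀ P : Place K (towerField K x i), IsDiscreteValuationRing P.ring := by
  induction i, hi using Nat.le_induction with
  | base =>
    exact fun P => P.isDiscreteValuationRing_of_transcendental
      (transcendental_towerGen_one x hx1) (adjoin_towerGen_one x)
  | succ i hi ih =>
    let := towerAlgebra K x (Nat.le_add_right i 1)
    have := isScalarTower_tower (K := K) x (Nat.le_add_right i 1)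
    obtain ⟨_, _⟩ := finiteDimensional_and_isSeparable_tower_step hq1 hq0 hn hi (hx i hi)
    exact Place.isDiscreteValuationRing_of_forall ih

/-- Each step of the tower is unramified at the places where its right-hand side is regular. -/
theorem ramificationIdx_tower_step_eq_one {g h : K[X]} (hq1 : 1 < q) (hq0 : (q : K) = 0)
    (hn : 0 < n) (hi : 1 ≤ i)
    (hx : ∑ j ∈ Finset.range n, x (i + 1) ^ q ^ j = aeval (x i) g / aeval (x i) h)
    {P : Place K (towerField K x i)} [IsDiscreteValuationRing P.ring]
    (hP : aeval (towerGen K x hi) g / aeval (towerGen K x hi) h ∈ P.ring)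
    {P' : Place K (towerField K x (i + 1))}
    (hP' : P' ∈ P.above (towerIncl K x (Nat.le_add_right i 1))) :
    P'.ramificationIdx (towerIncl K x (Nat.le_add_right i 1)) = 1 := by
  let := towerAlgebra K x (Nat.le_add_right i 1)
  have := isScalarTower_tower (K := K) x (Nat.le_add_right i 1)
  rw [← toAlgHom_eq_towerIncl] at hP' ⊢
  exact Place.ramificationIdx_eq_one_of_mem hq1 hq0 hn (adjoin_towerGen_succ x hi)
    (sum_towerGen_pow_eq x hi hx) hP hP'

/-- Above a pole of the right-hand side of the defining equation, the new generator has a pole. -/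
theorem notMem_of_above_of_notMem {g h : K[X]} (hi : 1 ≤ i)
    (hx : ∑ j ∈ Finset.range n, x (i + 1) ^ q ^ j = aeval (x i) g / aeval (x i) h)
    {P : Place K (towerField K x i)}
    (hP : aeval (towerGen K x hi) g / aeval (towerGen K x hi) h ∉ P.ring)
    {P' : Place K (towerField K x (i + 1))}
    (hP' : P' ∈ P.above (towerIncl K x (Nat.le_add_right i 1))) :
    towerGen K x (Nat.le_succ_of_le hi) ∉ P'.ring := by
  intro hmem
  refine hP ?_
  rw [← Place.mem_above_iff_ring.1 hP', ValuationSubring.mem_comap]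
  have hsum : ∑ j ∈ Finset.range n, towerGen K x (Nat.le_succ_of_le hi) ^ q ^ j ∈ P'.ring :=
    sum_mem fun j _ => pow_mem hmem _
  rw [sum_towerGen_pow_eq x hi hx] at hsum
  exact hsum

/-- A rational place splits completely, into rational places, in each step of the tower. -/
theorem tower_step_splitsCompletely_and_isRational {Fq : Type*} [Field Fq] [Finite Fq] [Finite K]
    [Algebra Fq K] (hq : Nat.card Fq = q) (hK : Nat.card K = q ^ n) (hn : 0 < n)
    {g h : Fq[X]} (hg : IsNQQuasiSymmetric n q g)
    (hh : IsNQQuasiSymmetric n q h) (hh0 : ∀ a : K, aeval a h ≠ 0)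
    (hdeg : g.natDegree ≤ h.natDegree) (hi : 1 ≤ i)
    (hx : ∑ j ∈ Finset.range n, x (i + 1) ^ q ^ j =
      aeval (x i) (g.map (algebraMap Fq K)) / aeval (x i) (h.map (algebraMap Fq K)))
    {P : Place K (towerField K x i)} [IsDiscreteValuationRing P.ring] (hP : P.IsRational) :
    P.SplitsCompletely (towerIncl K x (Nat.le_add_right i 1)) ∧
      ∀ P' ∈ P.above (towerIncl K x (Nat.le_add_right i 1)), P'.IsRational := by
  let := towerAlgebra K x (Nat.le_add_right i 1)
  have := isScalarTower_tower (K := K) x (Nat.le_add_right i 1)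
  obtain ⟨b, hb, hbv⟩ := P.exists_residue_pow_eq hq hK hg hh hh0 hdeg hP (towerGen K x hi)
  rw [← toAlgHom_eq_towerIncl]
  exact Place.splitsCompletely_and_isRational (hq ▸ Finite.one_lt_card)
    (natCast_eq_zero_of_natCard_eq hq K) hn (adjoin_towerGen_succ x hi)
    (sum_towerGen_pow_eq x hi hx) hP hbv (splits_tracePoly_sub_C hq hK hb)

theorem splitsCompletely_towerIncl_succ (hi : 1 ≤ i)
    (h1 : letI := towerAlgebra K x hi
      FiniteDimensional (towerField K x 1) (towerField K x i))
    (h2 : letI := towerAlgebra K x (Nat.le_add_right i 1)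
      FiniteDimensional (towerField K x i) (towerField K x (i + 1)))
    {P : Place K (towerField K x 1)} (hP : P.SplitsCompletely (towerIncl K x hi))
    (hQ : ∀ Q ∈ P.above (towerIncl K x hi),
      Q.SplitsCompletely (towerIncl K x (Nat.le_add_right i 1))) :
    P.SplitsCompletely (towerIncl K x (Nat.le_succ_of_le hi)) ∧
      letI := towerAlgebra K x (Nat.le_succ_of_le hi)
      FiniteDimensional (towerField K x 1) (towerField K x (i + 1)) := by
  let := towerAlgebra K x hi
  let := towerAlgebra K x (Nat.le_add_right i 1)
  let := towerAlgebra K x (Nat.le_succ_of_le hi)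
  have := isScalarTower_tower (K := K) x hi
  have := isScalarTower_tower (K := K) x (Nat.le_add_right i 1)
  have := isScalarTower_tower (K := K) x (Nat.le_succ_of_le hi)
  have := isScalarTower_towerField (K := K) x hi (Nat.le_add_right i 1)
  rw [← toAlgHom_eq_towerIncl] at hP hQ ⊢
  simp only [← toAlgHom_eq_towerIncl] at hQ
  exact ⟨Place.SplitsCompletely.trans hP hQ, FiniteDimensional.trans _ (towerField K x i) _⟩

theorem exists_mem_above_towerIncl (hi : 1 ≤ i)
    {P : Place K (towerField K x 1)} {Q : Place K (towerField K x (i + 1))}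
    (hQ : Q ∈ P.above (towerIncl K x (Nat.le_succ_of_le hi))) :
    ∃ Q' ∈ P.above (towerIncl K x hi), Q ∈ Q'.above (towerIncl K x (Nat.le_add_right i 1)) := by
  let := towerAlgebra K x hi
  let := towerAlgebra K x (Nat.le_add_right i 1)
  let := towerAlgebra K x (Nat.le_succ_of_le hi)
  have := isScalarTower_tower (K := K) x hi
  have := isScalarTower_tower (K := K) x (Nat.le_add_right i 1)
  have := isScalarTower_tower (K := K) x (Nat.le_succ_of_le hi)
  have := isScalarTower_towerField (K := K) x hi (Nat.le_add_right i 1)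
  exact Place.mem_above_iff_exists.1 hQ

end Tower

theorem mainTheorem3
    {Fq K Ω : Type*} [Field Fq] [Finite Fq] [Field K] [Finite K] [Field Ω]
    [Algebra Fq K] [Algebra K Ω]
    (q n : ℕ) (hn : 1 < n) (hq : Nat.card Fq = q) (hK : Nat.card K = q ^ n)
    -- the two polynomials of the defining equation
    (g h : Fq[X]) (hg : IsNQQuasiSymmetric n q g) (hh : IsNQQuasiSymmetric n q h)
    (hh0 : ∀ a : K, aeval a h ≠ 0) (hdeg : g.natDegree ≤ h.natDegree)
    -- `g/h` is not the image of a rational function under a linear polynomial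
    (hgh : ∀ L : K[X], IsLinearLeftFactor L (tracePoly K n q) → ∀ u : RatFunc K,
      aeval u L ≠ algebraMap K[X] (RatFunc K) (g.map (algebraMap Fq K)) /
        algebraMap K[X] (RatFunc K) (h.map (algebraMap Fq K)))
    -- the generators of the tower
    (x : ℕ → Ω) (hx1 : Transcendental K (x 1))
    (hx : ∀ i, 1 ≤ i → ∑ j ∈ Finset.range n, x (i + 1) ^ q ^ j =
      aeval (x i) (g.map (algebraMap Fq K)) / aeval (x i) (h.map (algebraMap Fq K))) :
    -- every rational place of `F_1` splits completely in `F_i`, and every place of `F_i` above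
    -- it splits completely in `F_{i+1}`
    (∀ P : Place K (towerField K x 1), P.IsRational → ∀ i (hi : 1 ≤ i),
      P.SplitsCompletely (towerIncl K x hi) ∧
      ∀ Q ∈ P.above (towerIncl K x hi), Q.SplitsCompletely (towerIncl K x (Nat.le_add_right i 1))) ∧
    -- a place that ramifies in one step is unramified in the next one
    (∀ i, 1 ≤ i → ∀ P : Place K (towerField K x i),
      P.IsRamified (towerIncl K x (Nat.le_add_right i 1)) →
      ∀ Q ∈ P.above (towerIncl K x (Nat.le_add_right i 1)),
        Q.IsUnramified (towerIncl K x (Nat.le_add_right (i + 1) 1))) := by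
  have hq1 : 1 < q := hq ▸ Finite.one_lt_card
  have hq0 : (q : K) = 0 := natCast_eq_zero_of_natCard_eq hq K
  have hn0 : 0 < n := by lia
  have hdvr (i : ℕ) (hi : 1 ≤ i) (P : Place K (towerField K x i)) :
      IsDiscreteValuationRing P.ring :=
    isDiscreteValuationRing_place_tower hq1 hq0 hn0 hx1 hx hi P
  constructor
  · intro P hP
    have hstep (i : ℕ) (hi : 1 ≤ i) (Q : Place K (towerField K x i)) (hQ : Q.IsRational) :
        Q.SplitsCompletely (towerIncl K x (Nat.le_add_right i 1)) ∧
          ∀ Q' ∈ Q.above (towerIncl K x (Nat.le_add_right i 1)), Q'.IsRational :=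
      have := hdvr i hi Q
      tower_step_splitsCompletely_and_isRational hq hK hn0 hg hh hh0 hdeg hi (hx i hi) hQ
    have hmain (i : ℕ) (hi : 1 ≤ i) : P.SplitsCompletely (towerIncl K x hi) ∧
        (∀ Q ∈ P.above (towerIncl K x hi), Q.IsRational) ∧
        letI := towerAlgebra K x hi
        FiniteDimensional (towerField K x 1) (towerField K x i) := by
      induction i, hi using Nat.le_induction with
      | base =>
        refine ⟨(splitsCompletely_towerIncl_refl x P).1, fun Q hQ => ?_, Module.Finite.self _⟩
        rwa [(splitsCompletely_towerIncl_refl x P).2 Q hQ]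
      | succ i hi ih =>
        obtain ⟨h1, h2, h3⟩ := ih
        have h4 := splitsCompletely_towerIncl_succ hi h3
          (finiteDimensional_and_isSeparable_tower_step hq1 hq0 hn0 hi (hx i hi)).1 h1
          fun Q hQ => (hstep i hi Q (h2 Q hQ)).1
        refine ⟨h4.1, fun Q hQ => ?_, h4.2⟩
        obtain ⟨Q', hQ', hQQ'⟩ := exists_mem_above_towerIncl hi hQ
        exact (hstep i hi Q' (h2 Q' hQ')).2 Q hQQ'
    exact fun i hi => ⟨(hmain i hi).1, fun Q hQ => (hstep i hi Q ((hmain i hi).2.1 Q hQ)).1⟩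
  · intro i hi P hP Q hQ Q' hQ'
    have := hdvr i hi P
    have := hdvr (i + 1) (Nat.le_succ_of_le hi) Q
    -- the right-hand side has a pole at the ramified place `P`, so `x_{i+1}` has a pole at `Q`
    have hpole : towerGen K x (Nat.le_succ_of_le hi) ∉ Q.ring := by
      refine notMem_of_above_of_notMem hi (hx i hi) (fun hc => ?_) hQ
      obtain ⟨P', hP', he⟩ := hP
      exact he.ne' (ramificationIdx_tower_step_eq_one hq1 hq0 hn0 hi (hx i hi) hc hP')
    -- hence the right-hand side of the next equation is regular at `Q`
    have hne : h ≠ 0 := by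
      rintro rfl
      exact hh0 0 (map_zero _)
    have hc := Q.ring.aeval_div_aeval_mem_of_notMem Q.algebraMap_mem hpole
      (G := g.map (algebraMap Fq K)) (Polynomial.map_ne_zero (f := algebraMap Fq K) hne)
      (by simpa using hdeg)
    exact ramificationIdx_tower_step_eq_one hq1 hq0 hn0 (Nat.le_succ_of_le hi)
      (hx (i + 1) (Nat.le_succ_of_le hi)) hc hQ'
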